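/- Let $(d_n)_{n\ge 0}$ be a dense sequence in $[0,1]$, let $(r_n)_{n\ge 0}$ be a strictly increasing sequence of natural numbers with $r_0\ge 2$, let $p_0=2<p_1=3<\cdots$ be the primes, $p_{-1}:=1$, and $q_k:=p_kp_{k-1}$. For every $k\ge 0$ let $e_A^k,e_B^k\in M_{q_k}=M_{q_k}(\mathbb C)$ be (self-adjoint) projections of rank $p_{k-1}$ and $p_k$ respectively. *Folding interval algebras.* Let $e\in M_q$ be a projection. Fix unital $*$-homomorphisms $i_0^l,i_1^l:M_q^{\otimes (l-1)}\to M_q^{\otimes l}$ ($l\ge 1$, $M_q^{\otimes 0}=\mathbb C$) such that $i_0^{l}(a)\otimes e+i_1^{l}(b)\otimes(1-e)\in \operatorname{im} i_0^{l+1}$ for all $a,b\in M_q^{\otimes(l-1)}$ and $x\otimes 1\in\operatorname{im} i_1^{l+1}$ for all $x\in M_q^{\otimes l}$, and continuous paths of unitaries $u_l:[0,1]\to M_q^{\otimes(l+1)}$ ($l\ge 1$) such that, for all $x\in M_q^{\otimes l}$, the function $\kappa_l(x):t\mapsto u_l(t)(x\otimes 1)u_l(t)^*$ satisfies $\kappa_l(x)(j)\in\operatorname{im}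 i_j^{l+1}$, $j=0,1$. (Such data exist for every $e$; the statement holds for every choice.) Put $$\mathcal I_{q,e}^l:=\{f\in C([0,1],M_q^{\otimes l}) : f(0)\in\operatorname{im} i_0^l,\ f(1)\in \operatorname{im} i_1^l\}.$$ For $l=1$ this is the dimension drop algebra. There are unital $*$-homomorphisms $\mathcal I_{q,e}^l\to\mathcal I_{q,e}^{l+1}$: the folding map $\psi_{l}(f)(t)=f(t/2)\otimes e+f(1-t/2)\otimes(1-e)$, and, for $x\in[0,1]$, the point evaluation $f\mapsto\kappa_l(f(x))$. Write $\mathcal I^l_{q_k}:=\mathcal I^l_{q_k,e_A^k}$ and $\mathcal J^l_{q_k}:=\mathcal I^l_{q_k,e_B^k}$. *The sequences.* For $0\le i<n$ let $[n,i]:=\prod_{j=i}^{n-1}q_i^{r_j}$, and $$A_n:=\bigoplus_{i=0}^{n-1}M_{[n,i]}(\mathcal I_{q_i}^{n-i})\oplus C([0,1]),\qquad B_n:=\bigoplus_{i=0}^{n-1}M_{[n,i]}(\mathcal J_{q_i}^{n-i})\oplus C([0,1]).$$ The connecting map $\phi_{n\,n+1}:A_n\to A_{n+1}$ sends the $i$-th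 block ($i<n$) to the $i$-th block by the block diagonal map (applied entrywise to matrices) $$f\mapsto \operatorname{diag}\bigl(\psi_{n-i}(f),\ \kappa_{n-i}(f(1/q_i^{r_n})),\ \dots,\ \kappa_{n-i}(f((q_i^{r_n}-1)/q_i^{r_n}))\bigr),$$ and sends $f\in C([0,1])$ to $f(0)1$ in the new $n$-th block $M_{q_n^{r_n}}(\mathcal I^1_{q_n})$ and to the constant function $f(d_n)$ in $C([0,1])$. The maps $\psi_{n\,n+1}:B_n\to B_{n+1}$ are defined in the same way. Let $A:=\varinjlim(A_n,\phi_{n\,n+1})$ and $B:=\varinjlim(B_n,\psi_{n\,n+1})$ be the inductive limits of C*-algebras. For $i<n$ let $I_{n,i}\subseteq A_n$ be the $i$-th block and $I_{n,i}^c$ the sum of all other summands of $A_n$ (including $C([0,1])$), and let $$\mathfrak s_i:=\varinjlim_{n>i} I_{n,i}=\overline{\bigcup_{n>i}\phi_{n\infty}(I_{n,i})},\qquad \mathfrak a_i:=\varinjlim_{n>i} I^c_{n,i}=\overline{\bigcup_{n>i}\phi_{n\infty}(I_{n,i}^c)}$$ in $A$; let $\mathfrak t_i,\mathfrak b_i\subseteq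 B$ be defined likewise from the blocks of $B_n$. Then: (i) The set of simple ideals of $A$ (closed two-sided ideals that are simple C*-algebras, in particular nonzero) is $\{\mathfrak s_i\}_{i\in\mathbb N}$, and the set of simple ideals of $B$ is $\{\mathfrak t_i\}_{i\in\mathbb N}$. (ii) For every $i\in\mathbb N$, $\mathfrak a_i,\mathfrak s_i$ are closed two-sided ideals of $A$ with $A=\mathfrak a_i\oplus\mathfrak s_i$, and $\mathfrak b_i,\mathfrak t_i$ are closed two-sided ideals of $B$ with $B=\mathfrak b_i\oplus\mathfrak t_i$. (iii) The sums $\sum_i\mathfrak s_i$ and $\sum_i\mathfrak t_i$ are direct, and, with $\bigoplus_i\mathfrak s_i$ and $\bigoplus_i\mathfrak t_i$ denoting their closures, $A/\bigoplus_{i}\mathfrak s_i\cong B/\bigoplus_i\mathfrak t_i\cong\mathbb C$ as C*-algebras. -/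

import Mathlib

open Filter Topology
open scoped unitInterval Kronecker Matrix.Norms.L2Operator

noncomputable section

namespace CStarLimit

variable {X : ℕ → Type*} [∀ n, CStarAlgebra (X n)] (φ : ∀ n, X n →⋆ₐ[ℂ] X (n + 1))

/-- The sequences that are eventually coherent for the connecting maps. -/
def coherent : StarSubalgebra ℂ (∀ n, X n) where
  carrier := {x | ∃ N, ∀ n, N ≤ n → x (n + 1) = φ n (x n)}
  mul_mem' := by
    rintro x y ⟨N, hN⟩ ⟨M, hM⟩
    exact ⟨max N M, fun n hn => by
      simp [hN n (le_trans (le_max_left _ _) hn), hM n (le_trans (le_max_right _ _) hn)]⟩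
  add_mem' := by
    rintro x y ⟨N, hN⟩ ⟨M, hM⟩
    exact ⟨max N M, fun n hn => by
      simp [hN n (le_trans (le_max_left _ _) hn), hM n (le_trans (le_max_right _ _) hn)]⟩
  algebraMap_mem' c := ⟨0, fun n _ => by
    simp only [Pi.algebraMap_apply]; exact ((φ n).toAlgHom.commutes c).symm⟩
  star_mem' := by
    rintro x ⟨N, hN⟩
    exact ⟨N, fun n hn => by simp [hN n hn, map_star]⟩

/-- The `*`-algebra of eventually coherent sequences; it carries the seminorm
`‖x‖ = lim ‖x n‖` defined below. -/
def PreLimit : Type _ := coherent φ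

namespace PreLimit

variable {φ}

instance : Ring (PreLimit φ) := inferInstanceAs (Ring (coherent φ))
instance : Algebra ℂ (PreLimit φ) := inferInstanceAs (Algebra ℂ (coherent φ))
instance : StarRing (PreLimit φ) := inferInstanceAs (StarRing (coherent φ))
instance : StarModule ℂ (PreLimit φ) := inferInstanceAs (StarModule ℂ (coherent φ))

/-- The underlying sequence. -/
def val : PreLimit φ →⋆ₐ[ℂ] (∀ n, X n) := (coherent φ).subtype

instance : Norm (PreLimit φ) := ⟨fun x => limsup (fun n => ‖val x n‖) atTop⟩

lemma tendsto_norm (x : PreLimit φ) : Tendsto (fun n => ‖val x n‖) atTop (𝓝 ‖x‖) := by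
  obtain ⟨N, hN⟩ : ∃ N, ∀ n, N ≤ n → val x (n + 1) = φ n (val x n) := x.2
  have hanti : Antitone (fun k => ‖val x (k + N)‖) := by
    refine antitone_nat_of_succ_le fun k => ?_
    have h := hN (k + N) (Nat.le_add_left _ _)
    rw [show k + 1 + N = k + N + 1 by omega, h]
    exact NonUnitalStarAlgHom.norm_apply_le (φ (k + N)) _
  have hbdd : BddBelow (Set.range (fun k => ‖val x (k + N)‖)) :=
    ⟨0, by rintro _ ⟨k, rfl⟩; exact norm_nonneg _⟩
  have h := tendsto_atTop_ciInf hanti hbdd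
  rw [tendsto_add_atTop_iff_nat (f := fun n => ‖val x n‖) N] at h
  have e : ‖x‖ = _ := h.limsup_eq
  rw [e]; exact h

/-- The seminorm `x ↦ lim ‖x n‖`. -/
def seminorm (φ : ∀ n, X n →⋆ₐ[ℂ] X (n + 1)) : RingSeminorm (PreLimit φ) where
  toFun x := ‖x‖
  map_zero' := by
    have h := tendsto_norm (0 : PreLimit φ)
    simp only [map_zero, Pi.zero_apply, norm_zero] at h
    exact tendsto_nhds_unique h tendsto_const_nhds
  add_le' x y := by
    refine le_of_tendsto_of_tendsto' (tendsto_norm (x + y))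
      ((tendsto_norm x).add (tendsto_norm y)) fun n => ?_
    simpa using norm_add_le _ _
  neg' x := by
    refine tendsto_nhds_unique (tendsto_norm (-x)) ?_
    simpa using tendsto_norm x
  mul_le' x y := by
    refine le_of_tendsto_of_tendsto' (tendsto_norm (x * y))
      ((tendsto_norm x).mul (tendsto_norm y)) fun n => ?_
    simpa using norm_mul_le _ _

instance : SeminormedRing (PreLimit φ) := (seminorm φ).toSeminormedRing

instance : NormedAlgebra ℂ (PreLimit φ) where
  norm_smul_le c x := by
    refine le_of_tendsto_of_tendsto' (tendsto_norm (c • x))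
      ((tendsto_norm x).const_mul ‖c‖) fun n => ?_
    simpa using norm_smul_le c (val x n)

lemma norm_star (x : PreLimit φ) : ‖star x‖ = ‖x‖ := by
  refine tendsto_nhds_unique (tendsto_norm (star x)) ?_
  simpa [map_star] using tendsto_norm x

lemma norm_star_mul_self (x : PreLimit φ) : ‖star x * x‖ = ‖x‖ * ‖x‖ := by
  refine tendsto_nhds_unique (tendsto_norm (star x * x)) ?_
  simpa [map_star, CStarRing.norm_star_mul_self] using (tendsto_norm x).mul (tendsto_norm x)

lemma isometry_star : Isometry (star : PreLimit φ → PreLimit φ) :=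
  AddMonoidHomClass.isometry_of_norm (starAddEquiv : PreLimit φ ≃+ PreLimit φ) norm_star

end PreLimit

/-- The inductive limit of a sequence of C⋆-algebras: the Hausdorff completion of the
`*`-algebra of eventually coherent sequences for the seminorm `lim ‖x n‖`. -/
def Limit : Type _ := UniformSpace.Completion (PreLimit φ)

namespace Limit

open UniformSpace

variable {φ}

instance : NormedRing (Limit φ) := inferInstanceAs (NormedRing (Completion (PreLimit φ)))
instance : CompleteSpace (Limit φ) := inferInstanceAs (CompleteSpace (Completion (PreLimit φ)))
instance : Algebra ℂ (Limit φ) := inferInstanceAs (Algebra ℂ (Completion (PreLimit φ)))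
instance : NormedAlgebra ℂ (Limit φ) where
  norm_smul_le c x := norm_smul_le (β := Completion (PreLimit φ)) c x

/-- The class in the limit of a coherent sequence. -/
def mk (x : PreLimit φ) : Limit φ := (x : Completion (PreLimit φ))

instance : Star (Limit φ) := ⟨Completion.map (star : PreLimit φ → PreLimit φ)⟩

lemma continuous_mk : Continuous (mk : PreLimit φ → Limit φ) := Completion.continuous_coe _
lemma denseRange_mk : DenseRange (mk : PreLimit φ → Limit φ) := Completion.denseRange_coe
lemma norm_mk (x : PreLimit φ) : ‖mk x‖ = ‖x‖ := Completion.norm_coe x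
lemma mk_add (x y : PreLimit φ) : mk (x + y) = mk x + mk y := Completion.coe_add x y
lemma mk_mul (x y : PreLimit φ) : mk (x * y) = mk x * mk y := Completion.coe_mul x y
lemma mk_one : mk (1 : PreLimit φ) = 1 := Completion.coe_one _
lemma mk_smul (c : ℂ) (x : PreLimit φ) : mk (c • x) = c • mk x := Completion.coe_smul c x
lemma mk_sub (x y : PreLimit φ) : mk (x - y) = mk x - mk y := Completion.coe_sub x y
lemma mk_algebraMap (c : ℂ) : mk (algebraMap ℂ (PreLimit φ) c) = algebraMap ℂ (Limit φ) c := rfl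
lemma star_mk (x : PreLimit φ) : star (mk x) = mk (star x) :=
  Completion.map_coe PreLimit.isometry_star.uniformContinuous x
lemma continuous_star' : Continuous (star : Limit φ → Limit φ) := Completion.continuous_map

instance : StarRing (Limit φ) where
  star_involutive x := by
    refine congrFun (f := fun x : Limit φ => star (star x)) (g := id) (denseRange_mk.equalizer
      (continuous_star'.comp continuous_star') continuous_id ?_) x
    funext a; simp [star_mk]
  star_mul x y := by
    refine congrFun (f := fun p : Limit φ × Limit φ => star (p.1 * p.2))
      (g := fun p => star p.2 * star p.1)
      ((denseRange_mk.prodMap denseRange_mk).equalizer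
      (continuous_star'.comp continuous_mul)
      ((continuous_star'.comp continuous_snd).mul (continuous_star'.comp continuous_fst)) ?_) (x, y)
    funext a; simp [star_mk, ← mk_mul]
  star_add x y := by
    refine congrFun (f := fun p : Limit φ × Limit φ => star (p.1 + p.2))
      (g := fun p => star p.1 + star p.2)
      ((denseRange_mk.prodMap denseRange_mk).equalizer
      (continuous_star'.comp continuous_add)
      ((continuous_star'.comp continuous_fst).add (continuous_star'.comp continuous_snd)) ?_) (x, y)
    funext a; simp [star_mk, ← mk_add]

instance : StarModule ℂ (Limit φ) where
  star_smul c x := by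
    refine congrFun (f := fun x : Limit φ => star (c • x))
      (g := fun x => star c • star x) (denseRange_mk.equalizer
      (continuous_star'.comp (continuous_const_smul c))
      (continuous_star'.const_smul (star c)) ?_) x
    funext a; simp [star_mk, ← mk_smul]

instance : CStarRing (Limit φ) where
  norm_mul_self_le x := by
    refine (congrFun (f := fun x : Limit φ => ‖x‖ * ‖x‖)
      (g := fun x => ‖star x * x‖) (denseRange_mk.equalizer
      (continuous_norm.mul continuous_norm)
      ((continuous_star'.mul continuous_id).norm) ?_) x).le
    funext a; simp [star_mk, ← mk_mul, norm_mk, PreLimit.norm_star_mul_self]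

instance : CStarAlgebra (Limit φ) where

end Limit

/-- The composite connecting map from stage `n` to stage `m`. -/
def trans {n m : ℕ} (h : n ≤ m) : X n →⋆ₐ[ℂ] X m :=
  Nat.leRec (motive := fun m _ => X n →⋆ₐ[ℂ] X m) (StarAlgHom.id ℂ (X n))
    (fun m _ f => (φ m).comp f) h

lemma trans_self (n : ℕ) (x : X n) : trans φ le_rfl x = x := by
  simp [trans]

lemma trans_succ {n m : ℕ} (h : n ≤ m) (x : X n) :
    trans φ (Nat.le_succ_of_le h) x = φ m (trans φ h x) := by
  rw [trans, Nat.leRec_succ (h1 := h)]; rfl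

/-- An element of stage `n`, followed along the connecting maps. -/
def thread (n : ℕ) (x : X n) : PreLimit φ :=
  ⟨fun m => if h : n ≤ m then trans φ h x else 0, n, fun m hm => by
    simp [hm, Nat.le_succ_of_le hm, trans_succ φ hm]⟩

lemma val_thread (n : ℕ) (x : X n) {m : ℕ} (h : n ≤ m) :
    PreLimit.val (thread φ n x) m = trans φ h x := dif_pos h

lemma mk_eq_mk_of_eventually (x y : PreLimit φ)
    (h : ∀ᶠ n in atTop, PreLimit.val x n = PreLimit.val y n) : Limit.mk x = Limit.mk y := by
  rw [← sub_eq_zero, ← Limit.mk_sub, ← norm_eq_zero, Limit.norm_mk]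
  refine tendsto_nhds_unique (PreLimit.tendsto_norm _) (tendsto_const_nhds.congr' ?_)
  filter_upwards [h] with n hn
  simp [hn]

/-- The canonical map from stage `n` to the inductive limit. -/
def toLimit (n : ℕ) : X n →⋆ₐ[ℂ] Limit φ where
  toFun x := Limit.mk (thread φ n x)
  map_one' := by
    rw [← Limit.mk_one]
    refine mk_eq_mk_of_eventually φ _ _ ?_
    filter_upwards [eventually_ge_atTop n] with m hm
    simp [val_thread φ n _ hm]
  map_mul' x y := by
    rw [← Limit.mk_mul]
    refine mk_eq_mk_of_eventually φ _ _ ?_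
    filter_upwards [eventually_ge_atTop n] with m hm
    simp [val_thread φ n _ hm]
  map_zero' := by
    have h0 : (0 : Limit φ) = Limit.mk 0 := UniformSpace.Completion.coe_zero.symm
    rw [h0]
    refine mk_eq_mk_of_eventually φ _ _ ?_
    filter_upwards [eventually_ge_atTop n] with m hm
    simp [val_thread φ n _ hm]
  map_add' x y := by
    rw [← Limit.mk_add]
    refine mk_eq_mk_of_eventually φ _ _ ?_
    filter_upwards [eventually_ge_atTop n] with m hm
    simp [val_thread φ n _ hm]
  commutes' c := by
    rw [← Limit.mk_algebraMap]
    refine mk_eq_mk_of_eventually φ _ _ ?_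
    filter_upwards [eventually_ge_atTop n] with m hm
    rw [val_thread φ n _ hm]
    simp [AlgHomClass.commutes]
  map_star' x := by
    rw [Limit.star_mk]
    refine mk_eq_mk_of_eventually φ _ _ ?_
    filter_upwards [eventually_ge_atTop n] with m hm
    simp [val_thread φ n _ hm, map_star]

lemma toLimit_comp (n : ℕ) (x : X n) : toLimit φ (n + 1) (φ n x) = toLimit φ n x := by
  refine mk_eq_mk_of_eventually φ _ _ ?_
  filter_upwards [eventually_ge_atTop (n + 1)] with m hm
  rw [val_thread φ _ _ hm, val_thread φ _ _ (Nat.le_of_succ_le hm)]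
  induction m, hm using Nat.le_induction with
  | base => rw [trans_self, trans_succ φ le_rfl, trans_self]
  | succ m hm ih => rw [trans_succ φ hm, trans_succ φ (Nat.le_of_succ_le hm), ih]

lemma tendsto_norm_toLimit (n : ℕ) (x : X n) :
    Tendsto (fun k => ‖trans φ (Nat.le_add_right n k) x‖) atTop (𝓝 ‖toLimit φ n x‖) := by
  have h := PreLimit.tendsto_norm (thread φ n x)
  rw [← Limit.norm_mk] at h
  have h2 : Tendsto (fun k => n + k) atTop atTop := tendsto_atTop_mono (Nat.le_add_left · n)
    tendsto_id
  exact (h.comp h2).congr fun k => by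
    simp only [Function.comp_apply, val_thread φ n x (Nat.le_add_right n k)]

lemma exists_eq_toLimit (x : PreLimit φ) : ∃ n y, Limit.mk x = toLimit φ n y := by
  obtain ⟨N, hN⟩ : ∃ N, ∀ n, N ≤ n → PreLimit.val x (n + 1) = φ n (PreLimit.val x n) := x.2
  refine ⟨N, PreLimit.val x N, mk_eq_mk_of_eventually φ _ _ ?_⟩
  filter_upwards [eventually_ge_atTop N] with m hm
  rw [val_thread φ _ _ hm]
  induction m, hm using Nat.le_induction with
  | base => rw [trans_self]
  | succ m hm ih => rw [trans_succ φ hm, hN m hm, ih]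

lemma dense_iUnion_range_toLimit : Dense (⋃ n, Set.range (toLimit φ n)) := by
  refine Dense.mono ?_ (Limit.denseRange_mk (φ := φ))
  rintro _ ⟨x, rfl⟩
  obtain ⟨n, y, h⟩ := exists_eq_toLimit φ x
  exact Set.mem_iUnion.2 ⟨n, y, h.symm⟩

end CStarLimit

namespace Folding

/-- The matrix algebra `M_q ⊗ ⋯ ⊗ M_q` (`l` factors), with its C⋆-norm; for `l = 0` it is `ℂ`. -/
abbrev TMat (q l : ℕ) : Type := Matrix (Fin l → Fin q) (Fin l → Fin q) ℂ

/-- Splitting off the last index. -/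
def splitLast (q l : ℕ) : (Fin (l + 1) → Fin q) ≃ (Fin l → Fin q) × Fin q where
  toFun s := (Fin.init s, s (Fin.last l))
  invFun p := Fin.snoc (α := fun _ => Fin q) p.1 p.2
  left_inv s := Fin.snoc_init_self s
  right_inv p := by simp

/-- The elementary tensor `x ⊗ y`, with `y` placed in the last factor. -/
def tens {q l : ℕ} (x : TMat q l) (y : Matrix (Fin q) (Fin q) ℂ) : TMat q (l + 1) :=
  (x ⊗ₖ y).submatrix (splitLast q l) (splitLast q l)

section tens

variable {q l : ℕ}

lemma tens_mul (x x' : TMat q l) (y y' : Matrix (Fin q) (Fin q) ℂ) :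
    tens x y * tens x' y' = tens (x * x') (y * y') := by
  simp [tens, Matrix.submatrix_mul_equiv, Matrix.mul_kronecker_mul]

lemma star_tens (x : TMat q l) (y : Matrix (Fin q) (Fin q) ℂ) :
    star (tens x y) = tens (star x) (star y) := by
  simp [tens, Matrix.star_eq_conjTranspose, Matrix.conjTranspose_submatrix,
    Matrix.conjTranspose_kronecker]

lemma tens_one_one : tens (1 : TMat q l) 1 = 1 := by
  simp [tens]

lemma add_tens (x x' : TMat q l) (y : Matrix (Fin q) (Fin q) ℂ) :
    tens (x + x') y = tens x y + tens x' y := by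
  rw [tens, Matrix.add_kronecker]; rfl

lemma tens_add (x : TMat q l) (y y' : Matrix (Fin q) (Fin q) ℂ) :
    tens x (y + y') = tens x y + tens x y' := by
  rw [tens, Matrix.kronecker_add]; rfl

lemma smul_tens (c : ℂ) (x : TMat q l) (y : Matrix (Fin q) (Fin q) ℂ) :
    tens (c • x) y = c • tens x y := by
  rw [tens, Matrix.smul_kronecker]; rfl

lemma zero_tens (y : Matrix (Fin q) (Fin q) ℂ) : tens (0 : TMat q l) y = 0 := by
  simp [tens]

lemma tens_zero (x : TMat q l) : tens x 0 = 0 := by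
  simp [tens]

lemma continuous_tens (y : Matrix (Fin q) (Fin q) ℂ) :
    Continuous (fun x : TMat q l => tens x y) := by
  refine continuous_matrix fun i j => ?_
  simp only [tens, Matrix.submatrix_apply]
  exact (continuous_id.matrix_elem _ _).mul continuous_const

end tens

variable {q : ℕ} {e : Matrix (Fin q) (Fin q) ℂ}

/-- The map `(a, b) ↦ a ⊗ e + b ⊗ (1 - e)` for a projection `e`. -/
def foldMat (he : IsStarProjection e) (l : ℕ) : TMat q l × TMat q l →⋆ₐ[ℂ] TMat q (l + 1) where
  toFun p := tens p.1 e + tens p.2 (1 - e)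
  map_one' := by
    simp only [Prod.fst_one, Prod.snd_one]
    rw [← tens_add, add_sub_cancel, tens_one_one]
  map_mul' p p' := by
    have h1 : e * (1 - e) = 0 := by rw [mul_sub, mul_one, he.isIdempotentElem.eq, sub_self]
    have h2 : (1 - e) * e = 0 := by rw [sub_mul, one_mul, he.isIdempotentElem.eq, sub_self]
    simp only [add_mul, mul_add, tens_mul, Prod.fst_mul, Prod.snd_mul, h1, h2, tens_zero,
      add_zero, zero_add, he.isIdempotentElem.eq, he.one_sub.isIdempotentElem.eq]
  map_zero' := by simp [zero_tens]
  map_add' p p' := by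
    simp only [Prod.fst_add, Prod.snd_add, add_tens]; abel
  commutes' c := by
    simp only [Algebra.algebraMap_eq_smul_one, Prod.smul_fst, Prod.smul_snd, Prod.fst_one,
      Prod.snd_one, smul_tens]
    rw [← smul_add, ← tens_add, add_sub_cancel, tens_one_one]
  map_star' p := by
    simp only [star_add, star_tens, Prod.fst_star, Prod.snd_star, he.isSelfAdjoint.star_eq,
      he.one_sub.isSelfAdjoint.star_eq]

lemma continuous_foldMat (he : IsStarProjection e) (l : ℕ) : Continuous (foldMat he l) :=
  ((continuous_tens e).comp continuous_fst).add ((continuous_tens (1 - e)).comp continuous_snd)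

variable (q e) in
/-- The boundary data of the folding interval algebras for the projection `e` of `M_q`.

The unital `*`-homomorphisms `i₀ l, i₁ l : M_q^{⊗ l} → M_q^{⊗ (l + 1)}` give the boundary
conditions at `0` and `1` of the algebra of level `l + 1` (for `l = 0` these are the scalars, so that
the first algebra is the dimension drop algebra). The conditions `fold₀`, `fold₁` say exactly that
`f ↦ f(t / 2) ⊗ e + f(1 - t / 2) ⊗ (1 - e)` maps each algebra to the next one. The unitaries `u`
correct the constant functions `x ⊗ 1` pointwise, so that they satisfy the boundary conditions.
For every projection such data exist, see `BoundaryData.standard`. -/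
structure BoundaryData where
  i₀ : ∀ l, TMat q l →⋆ₐ[ℂ] TMat q (l + 1)
  i₁ : ∀ l, TMat q l →⋆ₐ[ℂ] TMat q (l + 1)
  fold₀ : ∀ l a b, tens (i₀ l a) e + tens (i₁ l b) (1 - e) ∈ (i₀ (l + 1)).range
  fold₁ : ∀ l (x : TMat q (l + 1)), tens x 1 ∈ (i₁ (l + 1)).range
  u : ∀ l, C(I, TMat q (l + 2))
  u_mem : ∀ l t, u l t ∈ unitary (TMat q (l + 2))
  u₀ : ∀ l (x : TMat q (l + 1)), u l 0 * tens x 1 * star (u l 0) ∈ (i₀ (l + 1)).range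
  u₁ : ∀ l (x : TMat q (l + 1)), u l 1 * tens x 1 * star (u l 1) ∈ (i₁ (l + 1)).range

section existence

/-- Exchanging the last two indices. -/
def swapIdx (q l : ℕ) : Equiv.Perm (Fin (l + 2) → Fin q) :=
  Equiv.arrowCongr (Equiv.swap (Fin.last (l + 1)) (Fin.last l).castSucc) (Equiv.refl _)

lemma swapIdx_symm (l : ℕ) : (swapIdx q l).symm = swapIdx q l := rfl

lemma swapIdx_last (l : ℕ) (s : Fin (l + 2) → Fin q) :
    swapIdx q l s (Fin.last (l + 1)) = s (Fin.last l).castSucc := by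
  simp [swapIdx]

lemma swapIdx_castSucc (l : ℕ) (s : Fin (l + 2) → Fin q) :
    swapIdx q l s (Fin.last l).castSucc = s (Fin.last (l + 1)) := by
  simp [swapIdx]

lemma swapIdx_init (l : ℕ) (s : Fin (l + 2) → Fin q) :
    Fin.init (Fin.init (swapIdx q l s) : Fin (l + 1) → Fin q) =
      (Fin.init (Fin.init s : Fin (l + 1) → Fin q) : Fin l → Fin q) := by
  funext i
  have h1 : i.castSucc.castSucc ≠ Fin.last (l + 1) := Fin.castSucc_ne_last _
  have h2 : i.castSucc.castSucc ≠ (Fin.last l).castSucc := fun h =>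
    Fin.castSucc_ne_last i (Fin.castSucc_injective _ h)
  simp [swapIdx, Fin.init, Equiv.swap_apply_of_ne_of_ne h1 h2]

/-- The exchange of the last two tensor factors. -/
def flip (q l : ℕ) : TMat q (l + 2) := (1 : TMat q (l + 2)).submatrix (swapIdx q l) id

lemma flip_mul (l : ℕ) (x : TMat q (l + 2)) : flip q l * x = x.submatrix (swapIdx q l) id := by
  have h := Matrix.submatrix_mul_equiv (1 : TMat q (l + 2)) x (swapIdx q l) (Equiv.refl _) id
  rw [one_mul] at h
  exact h

lemma flip_apply (l : ℕ) (s t : Fin (l + 2) → Fin q) :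
    flip q l s t = if swapIdx q l s = t then 1 else 0 := rfl

lemma swapIdx_swapIdx (l : ℕ) (s : Fin (l + 2) → Fin q) : swapIdx q l (swapIdx q l s) = s :=
  (swapIdx q l).symm_apply_apply s

lemma swapIdx_eq_iff (l : ℕ) (s t : Fin (l + 2) → Fin q) :
    swapIdx q l s = t ↔ s = swapIdx q l t := (swapIdx q l).eq_symm_apply.symm

lemma mul_flip (l : ℕ) (x : TMat q (l + 2)) : x * flip q l = x.submatrix id (swapIdx q l) := by
  ext s t
  simp [Matrix.mul_apply, flip_apply, swapIdx_eq_iff]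

lemma flip_mul_flip (l : ℕ) : flip q l * flip q l = 1 := by
  rw [flip_mul]
  ext s t
  rw [Matrix.submatrix_apply, flip_apply, swapIdx_swapIdx, Matrix.one_apply, id]

lemma star_flip (l : ℕ) : star (flip q l) = flip q l := by
  ext s t
  rw [Matrix.star_apply, flip_apply, flip_apply]
  simp only [swapIdx_eq_iff, eq_comm (a := t)]
  split_ifs <;> simp

lemma flip_conj (l : ℕ) (x : TMat q l) (y z : Matrix (Fin q) (Fin q) ℂ) :
    flip q l * tens (tens x y) z * flip q l = tens (tens x z) y := by
  have h : flip q l * tens (tens x y) z = tens (tens x z) y * flip q l := by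
    rw [flip_mul, mul_flip]
    ext s t
    have h1 := swapIdx_last l s
    have h2 := swapIdx_castSucc l s
    have h3 := swapIdx_init l s
    have h1' := swapIdx_last l t
    have h2' := swapIdx_castSucc l t
    have h3' := swapIdx_init l t
    simp only [tens, splitLast, Matrix.submatrix_apply, Matrix.kronecker_apply, Equiv.coe_fn_mk, id]
    rw [h1, h3, h1', h3']
    simp only [Fin.init] at *
    rw [h2, h2']
    ring
  rw [h, mul_assoc, flip_mul_flip, mul_one]

/-- A path of unitaries from the exchange of the last two tensor factors to the identity. -/
def flipPath (q l : ℕ) : C(I, TMat q (l + 2)) where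
  toFun t := (1 / 2 : ℂ) • (1 + flip q l) +
    (Complex.exp (Real.pi * (1 - (t : ℝ)) * Complex.I) / 2) • (1 - flip q l)
  continuous_toFun := by fun_prop

lemma flipPath_apply (l : ℕ) (t : I) : flipPath q l t = (1 / 2 : ℂ) • (1 + flip q l) +
    (Complex.exp (Real.pi * (1 - (t : ℝ)) * Complex.I) / 2) • (1 - flip q l) := rfl

lemma flipPath_zero (l : ℕ) : flipPath q l 0 = flip q l := by
  have h : Complex.exp (Real.pi * (1 - ((0 : I) : ℝ)) * Complex.I) = -1 := by
    simp [Complex.exp_pi_mul_I]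
  rw [flipPath_apply, h]
  module

lemma flipPath_one (l : ℕ) : flipPath q l 1 = 1 := by
  have h : Complex.exp (Real.pi * (1 - ((1 : I) : ℝ)) * Complex.I) = 1 := by simp
  rw [flipPath_apply, h]
  module

lemma flipPath_mem (l : ℕ) (t : I) : flipPath q l t ∈ unitary (TMat q (l + 2)) := by
  set z := Complex.exp (Real.pi * (1 - (t : ℝ)) * Complex.I) with hz
  have hz1 : star z * z = 1 := by
    have : ‖z‖ = 1 := by
      rw [hz]; exact_mod_cast Complex.norm_exp_ofReal_mul_I (Real.pi * (1 - (t : ℝ)))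
    rw [Complex.star_def, ← Complex.normSq_eq_conj_mul_self, Complex.normSq_eq_norm_sq, this]
    simp
  have hf := flip_mul_flip (q := q) l
  have a1 : (1 + flip q l) * (1 + flip q l) = (2 : ℂ) • (1 + flip q l) := by
    simp only [add_mul, mul_add, one_mul, mul_one, hf]; module
  have a2 : (1 + flip q l) * (1 - flip q l) = 0 := by
    simp only [add_mul, mul_sub, one_mul, mul_one, hf]; module
  have a3 : (1 - flip q l) * (1 + flip q l) = 0 := by
    simp only [sub_mul, mul_add, one_mul, mul_one, hf]; module
  have a4 : (1 - flip q l) * (1 - flip q l) = (2 : ℂ) • (1 - flip q l) := by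
    simp only [sub_mul, mul_sub, one_mul, mul_one, hf]; module
  have e : flipPath q l t = (1 / 2 : ℂ) • (1 + flip q l) + (z / 2) • (1 - flip q l) := rfl
  have es : star (flipPath q l t) =
      (1 / 2 : ℂ) • (1 + flip q l) + (star z / 2) • (1 - flip q l) := by
    rw [e]; simp [star_flip]
  have hz2 : z * star z = 1 := by rw [mul_comm]; exact hz1
  rw [Unitary.mem_iff]
  constructor
  · rw [es, e]
    simp only [add_mul, mul_add, smul_mul_smul_comm, a1, a2, a3, a4, smul_zero, add_zero, zero_add,
      smul_smul]
    rw [show star z / 2 * (z / 2) * 2 = 1 / 2 by linear_combination hz1 / 2]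
    module
  · rw [es, e]
    simp only [add_mul, mul_add, smul_mul_smul_comm, a1, a2, a3, a4, smul_zero, add_zero, zero_add,
      smul_smul]
    rw [show z / 2 * (star z / 2) * 2 = 1 / 2 by linear_combination hz2 / 2]
    module

variable (he : IsStarProjection e)

/-- The passage from one level to the next in `unitaryPath`. -/
def nextPath (l : ℕ) (v : C(I, TMat q (l + 1))) : C(I, TMat q (l + 2)) :=
  (⟨foldMat he (l + 1), continuous_foldMat he (l + 1)⟩ : C(_, _)).comp (v.prodMk 1) * flipPath q l

lemma nextPath_apply (l : ℕ) (v : C(I, TMat q (l + 1))) (t : I) :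
    nextPath he l v t = foldMat he (l + 1) (v t, 1) * flipPath q l t := rfl

/-- Recursively defined paths of unitaries that connect the two boundary conditions. -/
def unitaryPath : ∀ l, C(I, TMat q (l + 1))
  | 0 => 1
  | l + 1 => nextPath he l (unitaryPath l)

lemma unitaryPath_succ (l : ℕ) : unitaryPath he (l + 1) = nextPath he l (unitaryPath he l) := rfl

lemma unitaryPath_mem (l : ℕ) (t : I) : unitaryPath he l t ∈ unitary (TMat q (l + 1)) := by
  induction l with
  | zero => exact one_mem _
  | succ l ih =>
    rw [unitaryPath_succ, nextPath_apply]
    refine mul_mem ?_ (flipPath_mem l t)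
    refine Unitary.map_mem (foldMat he (l + 1)) ?_
    rw [Unitary.mem_iff] at ih ⊢
    exact ⟨Prod.ext ih.1 (by simp), Prod.ext ih.2 (by simp)⟩

lemma unitaryPath_one (l : ℕ) : unitaryPath he l 1 = 1 := by
  induction l with
  | zero => rfl
  | succ l ih =>
    rw [unitaryPath_succ, nextPath_apply, ih, flipPath_one, mul_one]
    exact map_one _

/-- The map `x ↦ x ⊗ 1`. -/
def tensOne (q l : ℕ) : TMat q l →⋆ₐ[ℂ] TMat q (l + 1) where
  toFun x := tens x 1
  map_one' := tens_one_one
  map_mul' x y := by rw [tens_mul, mul_one]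
  map_zero' := zero_tens 1
  map_add' x y := add_tens x y 1
  commutes' c := by
    simp only [Algebra.algebraMap_eq_smul_one, smul_tens, tens_one_one]
  map_star' x := by rw [star_tens, star_one]

/-- Conjugation by a unitary. -/
def conjHom {R : Type} [CStarAlgebra R] {v : R} (hv : v ∈ unitary R) : R →⋆ₐ[ℂ] R where
  toFun x := v * x * star v
  map_one' := by rw [mul_one]; exact (Unitary.mem_iff.1 hv).2
  map_mul' x y := by
    have h := (Unitary.mem_iff.1 hv).1
    calc v * (x * y) * star v = v * x * (1 * (y * star v)) := by noncomm_ring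
      _ = _ := by rw [← h]; noncomm_ring
  map_zero' := by simp
  map_add' x y := by noncomm_ring
  commutes' c := by
    rw [← Algebra.commutes, mul_assoc, (Unitary.mem_iff.1 hv).2, mul_one]
  map_star' x := by simp [mul_assoc]

lemma standard_fold₀ (l : ℕ) (a b : TMat q l) :
    unitaryPath he (l + 1) 0 * tens (foldMat he l (a, b)) 1 * star (unitaryPath he (l + 1) 0) =
      tens (unitaryPath he l 0 * tens a 1 * star (unitaryPath he l 0)) e + tens (tens b 1) (1 - e) := by
  have h1 : flip q l * tens (foldMat he l (a, b)) 1 * flip q l =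
      foldMat he (l + 1) (tens a 1, tens b 1) := by
    change flip q l * tens (tens a e + tens b (1 - e)) 1 * flip q l =
      tens (tens a 1) e + tens (tens b 1) (1 - e)
    rw [add_tens, mul_add, add_mul, flip_conj, flip_conj]
  have h2 : unitaryPath he (l + 1) 0 = foldMat he (l + 1) (unitaryPath he l 0, 1) * flip q l := by
    rw [unitaryPath_succ, nextPath_apply, flipPath_zero]
  rw [h2, star_mul, star_flip, ← map_star]
  calc _ = foldMat he (l + 1) (unitaryPath he l 0, 1) *
        (flip q l * tens (foldMat he l (a, b)) 1 * flip q l) *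
        foldMat he (l + 1) (star (unitaryPath he l 0, 1)) := by simp only [mul_assoc]
    _ = foldMat he (l + 1) ((unitaryPath he l 0, 1) * (tens a 1, tens b 1) *
        star (unitaryPath he l 0, 1)) := by rw [h1, map_mul, map_mul]
    _ = foldMat he (l + 1) (unitaryPath he l 0 * tens a 1 * star (unitaryPath he l 0),
        tens b 1) := by
      congr 1
      ext1 <;> simp

/-- For every projection `e` there are boundary data. -/
def BoundaryData.standard : BoundaryData q e where
  i₀ l := (conjHom (unitaryPath_mem he l 0)).comp (tensOne q l)
  i₁ l := tensOne q l
  fold₀ l a b := ⟨foldMat he l (a, b), standard_fold₀ he l a b⟩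
  fold₁ l x := ⟨x, rfl⟩
  u l := unitaryPath he (l + 1)
  u_mem l t := unitaryPath_mem he (l + 1) t
  u₀ l x := ⟨x, rfl⟩
  u₁ l x := ⟨x, by rw [unitaryPath_one, one_mul, star_one, mul_one]; rfl⟩

end existence

/-- The folding interval algebra of level `l + 1`. -/
def foldSub (D : BoundaryData q e) (l : ℕ) : StarSubalgebra ℂ C(I, TMat q (l + 1)) where
  carrier := {f | f 0 ∈ (D.i₀ l).range ∧ f 1 ∈ (D.i₁ l).range}
  mul_mem' hf hg := ⟨mul_mem hf.1 hg.1, mul_mem hf.2 hg.2⟩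
  add_mem' hf hg := ⟨add_mem hf.1 hg.1, add_mem hf.2 hg.2⟩
  algebraMap_mem' c := ⟨algebraMap_mem (D.i₀ l).range c, algebraMap_mem (D.i₁ l).range c⟩
  star_mem' hf := ⟨star_mem hf.1, star_mem hf.2⟩

lemma isClosed_range {k l : ℕ} (i : TMat q k →⋆ₐ[ℂ] TMat q l) :
    IsClosed (i.range : Set (TMat q l)) :=
  Submodule.closed_of_finiteDimensional (LinearMap.range i.toLinearMap)

instance isClosed_foldSub (D : BoundaryData q e) (l : ℕ) :
    IsClosed (foldSub D l : Set C(I, TMat q (l + 1))) :=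
  ((isClosed_range (D.i₀ l)).preimage (continuous_eval_const 0)).inter
    ((isClosed_range (D.i₁ l)).preimage (continuous_eval_const 1))

/-- The folding interval algebra of level `l + 1`: the continuous functions
`f : [0,1] → M_q^{⊗ (l + 1)}` with `f 0` in the range of `i₀` and `f 1` in the range of `i₁`.
(Since `i₀` and `i₁` are injective, this is the pullback of
`C([0,1], M_q^{⊗ (l + 1)})` and `M_q^{⊗ l} ⊕ M_q^{⊗ l}` along the endpoint evaluations and
`(i₀, i₁)`.) -/
def FoldAlg (D : BoundaryData q e) (l : ℕ) : Type := foldSub D l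

namespace FoldAlg

instance (D : BoundaryData q e) (l : ℕ) : CStarAlgebra (FoldAlg D l) :=
  inferInstanceAs (CStarAlgebra (foldSub D l))

instance (D : BoundaryData q e) (l : ℕ) : PartialOrder (FoldAlg D l) :=
  CStarAlgebra.spectralOrder _

instance (D : BoundaryData q e) (l : ℕ) : StarOrderedRing (FoldAlg D l) :=
  CStarAlgebra.spectralOrderedRing _

variable (D : BoundaryData q e)

/-- The inclusion in the algebra of all continuous functions. -/
def incl (l : ℕ) : FoldAlg D l →⋆ₐ[ℂ] C(I, TMat q (l + 1)) := (foldSub D l).subtype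

/-- A `*`-homomorphism into all continuous functions that respects the boundary conditions. -/
def codRestrict {R : Type} [CStarAlgebra R] (l : ℕ) (f : R →⋆ₐ[ℂ] C(I, TMat q (l + 1)))
    (h : ∀ x, f x ∈ foldSub D l) : R →⋆ₐ[ℂ] FoldAlg D l :=
  StarAlgHom.codRestrict f (foldSub D l) h

end FoldAlg

/-- The path `t ↦ t / 2`. -/
def xi₀ : C(I, I) := ⟨fun t => ⟨t / 2, by constructor <;> linarith [t.2.1, t.2.2]⟩, by fun_prop⟩

/-- The path `t ↦ 1 - t / 2`. -/
def xi₁ : C(I, I) :=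
  ⟨fun t => ⟨1 - t / 2, by constructor <;> linarith [t.2.1, t.2.2]⟩, by fun_prop⟩


namespace FoldAlg

variable (he : IsStarProjection e) (D : BoundaryData q e)

/-- The function `t ↦ f(t / 2) ⊗ e + f(1 - t / 2) ⊗ (1 - e)`. -/
def foldFun (l : ℕ) (f : C(I, TMat q (l + 1))) : C(I, TMat q (l + 2)) :=
  (⟨foldMat he (l + 1), continuous_foldMat he (l + 1)⟩ : C(_, _)).comp
    ((f.comp xi₀).prodMk (f.comp xi₁))

lemma foldFun_apply (l : ℕ) (f : C(I, TMat q (l + 1))) (t : I) :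
    foldFun he l f t = tens (f (xi₀ t)) e + tens (f (xi₁ t)) (1 - e) := rfl

/-- The folding map `f ↦ f(ξ₀) ⊗ e + f(ξ₁) ⊗ (1 - e)` between consecutive folding interval
algebras. -/
def fold (l : ℕ) : FoldAlg D l →⋆ₐ[ℂ] FoldAlg D (l + 1) :=
  codRestrict D (l + 1)
    { toFun := fun f => foldFun he l (incl D l f)
      map_one' := by
        ext1 t; exact map_one (foldMat he (l + 1))
      map_mul' := fun f g => by
        ext1 t; exact map_mul (foldMat he (l + 1)) (incl D l f (xi₀ t), incl D l f (xi₁ t))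
          (incl D l g (xi₀ t), incl D l g (xi₁ t))
      map_zero' := by
        ext1 t; exact map_zero (foldMat he (l + 1))
      map_add' := fun f g => by
        ext1 t; exact map_add (foldMat he (l + 1)) (incl D l f (xi₀ t), incl D l f (xi₁ t))
          (incl D l g (xi₀ t), incl D l g (xi₁ t))
      commutes' := fun c => by
        ext1 t; exact AlgHomClass.commutes (foldMat he (l + 1)) c
      map_star' := fun f => by
        ext1 t; exact map_star (foldMat he (l + 1)) (incl D l f (xi₀ t), incl D l f (xi₁ t)) }
    (by
      intro f
      obtain ⟨a, ha⟩ := f.2.1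
      obtain ⟨b, hb⟩ := f.2.2
      have h0 : xi₀ 0 = 0 := by ext; simp [xi₀]
      have h1 : xi₁ 0 = 1 := by ext; simp [xi₁]
      have h2 : xi₁ 1 = xi₀ 1 := by ext; simp [xi₀, xi₁]; norm_num
      constructor
      · change foldFun he l (incl D l f) 0 ∈ _
        rw [foldFun_apply, h0, h1]
        have ha' : incl D l f 0 = D.i₀ l a := ha.symm
        have hb' : incl D l f 1 = D.i₁ l b := hb.symm
        rw [ha', hb']
        exact D.fold₀ l a b
      · change foldFun he l (incl D l f) 1 ∈ _
        rw [foldFun_apply, h2, ← tens_add, add_sub_cancel]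
        exact D.fold₁ l _)

/-- The point evaluation `f ↦ f(x) ⊗ 1`, corrected pointwise by the unitaries of the boundary
data: `f` is sent to the function `t ↦ u(t) (f(x) ⊗ 1) u(t)⋆`. -/
def pointEval (x : I) (l : ℕ) : FoldAlg D l →⋆ₐ[ℂ] FoldAlg D (l + 1) :=
  codRestrict D (l + 1)
    { toFun := fun f => ⟨fun t => D.u l t * tens (incl D l f x) 1 * star (D.u l t), by fun_prop⟩
      map_one' := by
        ext1 t; exact map_one ((conjHom (D.u_mem l t)).comp (tensOne q (l + 1)))
      map_mul' := fun f g => by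
        ext1 t; exact map_mul ((conjHom (D.u_mem l t)).comp (tensOne q (l + 1)))
          (incl D l f x) (incl D l g x)
      map_zero' := by
        ext1 t; exact map_zero ((conjHom (D.u_mem l t)).comp (tensOne q (l + 1)))
      map_add' := fun f g => by
        ext1 t; exact map_add ((conjHom (D.u_mem l t)).comp (tensOne q (l + 1)))
          (incl D l f x) (incl D l g x)
      commutes' := fun c => by
        ext1 t; exact AlgHomClass.commutes ((conjHom (D.u_mem l t)).comp (tensOne q (l + 1))) c
      map_star' := fun f => by
        ext1 t; exact map_star ((conjHom (D.u_mem l t)).comp (tensOne q (l + 1)))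
          (incl D l f x) }
    (fun f => ⟨D.u₀ l (incl D l f x), D.u₁ l (incl D l f x)⟩)

end FoldAlg

/-- The block diagonal matrix `diag(h 0 (f), …, h (Q - 1) (f))`, where each `h s` is applied to the
entries of `f`. -/
def diagFun {R S : Type} [CStarAlgebra R] [CStarAlgebra S] {Q k : ℕ} (h : Fin Q → R →⋆ₐ[ℂ] S)
    (f : CStarMatrix (Fin k) (Fin k) R) : CStarMatrix (Fin (Q * k)) (Fin (Q * k)) S :=
  CStarMatrix.ofMatrix (Matrix.of fun a b =>
    if (finProdFinEquiv.symm a).1 = (finProdFinEquiv.symm b).1 then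
      h (finProdFinEquiv.symm a).1 (f (finProdFinEquiv.symm a).2 (finProdFinEquiv.symm b).2)
    else 0)

lemma diagFun_apply {R S : Type} [CStarAlgebra R] [CStarAlgebra S] {Q k : ℕ}
    (h : Fin Q → R →⋆ₐ[ℂ] S) (f : CStarMatrix (Fin k) (Fin k) R) (s t : Fin Q) (a b : Fin k) :
    diagFun h f (finProdFinEquiv (s, a)) (finProdFinEquiv (t, b)) =
      if s = t then h s (f a b) else 0 := by
  have h0 : ∀ x y, diagFun h f x y =
      if (finProdFinEquiv.symm x).1 = (finProdFinEquiv.symm y).1 then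
      h (finProdFinEquiv.symm x).1 (f (finProdFinEquiv.symm x).2 (finProdFinEquiv.symm y).2)
      else 0 := fun _ _ => rfl
  rw [h0, Equiv.symm_apply_apply, Equiv.symm_apply_apply]

lemma ext_prod {S : Type} {Q k : ℕ} {f g : CStarMatrix (Fin (Q * k)) (Fin (Q * k)) S}
    (h : ∀ s a t b, f (finProdFinEquiv (s, a)) (finProdFinEquiv (t, b)) =
      g (finProdFinEquiv (s, a)) (finProdFinEquiv (t, b))) : f = g := by
  refine CStarMatrix.ext fun x y => ?_
  obtain ⟨⟨s, a⟩, rfl⟩ := finProdFinEquiv.surjective x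
  obtain ⟨⟨t, b⟩, rfl⟩ := finProdFinEquiv.surjective y
  exact h s a t b

/-- The block diagonal map `f ↦ diag(h 0 (f), …, h (Q - 1) (f))` on matrix algebras. -/
def diagHom {R S : Type} [CStarAlgebra R] [CStarAlgebra S] {Q k : ℕ} (h : Fin Q → R →⋆ₐ[ℂ] S) :
    CStarMatrix (Fin k) (Fin k) R →⋆ₐ[ℂ] CStarMatrix (Fin (Q * k)) (Fin (Q * k)) S where
  toFun := diagFun h
  map_one' := ext_prod fun s a t b => by
    rw [diagFun_apply, CStarMatrix.one_apply, CStarMatrix.one_apply]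
    simp only [EmbeddingLike.apply_eq_iff_eq, Prod.mk.injEq]
    split_ifs <;> simp_all
  map_mul' f g := ext_prod fun s a t b => by
    rw [diagFun_apply, CStarMatrix.mul_apply, CStarMatrix.mul_apply,
      ← finProdFinEquiv.sum_comp, Fintype.sum_prod_type]
    simp only [diagFun_apply]
    rw [Finset.sum_eq_single s]
    · by_cases hst : s = t
      · subst hst; simp
      · simp [hst]
    · intro s' _ hs
      simp [Ne.symm hs]
    · simp
  map_zero' := ext_prod fun s a t b => by
    rw [diagFun_apply, CStarMatrix.zero_apply, CStarMatrix.zero_apply, map_zero, ite_self]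
  map_add' f g := ext_prod fun s a t b => by
    rw [CStarMatrix.add_apply, diagFun_apply, diagFun_apply, diagFun_apply, CStarMatrix.add_apply]
    split_ifs <;> simp
  commutes' c := ext_prod fun s a t b => by
    rw [diagFun_apply, CStarMatrix.algebraMap_apply, CStarMatrix.algebraMap_apply]
    simp only [EmbeddingLike.apply_eq_iff_eq, Prod.mk.injEq]
    split_ifs <;> simp_all [AlgHomClass.commutes]
  map_star' f := ext_prod fun s a t b => by
    rw [CStarMatrix.star_apply, diagFun_apply, diagFun_apply, CStarMatrix.star_apply]
    simp only [eq_comm (a := t)]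
    split_ifs with hst
    · subst hst; exact map_star (h s) _
    · simp

end Folding

/-- The parameters of the inductive sequence: the sizes `q k`, the exponents `r k`, the points
`d k`, and for each `k` a projection in `M_{q k}` with boundary data. -/
structure BlockSystem where
  q : ℕ → ℕ
  r : ℕ → ℕ
  d : ℕ → I
  e : ∀ k, Matrix (Fin (q k)) (Fin (q k)) ℂ
  he : ∀ k, IsStarProjection (e k)
  bd : ∀ k, Folding.BoundaryData (q k) (e k)

namespace BlockSystem

open Folding

variable (S : BlockSystem)

/-- The matrix size `[n, i] = ∏_{i ≤ j < n} q_i ^ r_j` for `n = i + l + 1`. -/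
def size (i : ℕ) : ℕ → ℕ
  | 0 => S.q i ^ S.r i
  | l + 1 => S.q i ^ S.r (i + l + 1) * size i l

lemma size_eq (i l : ℕ) : S.size i l = ∏ j ∈ Finset.Ico i (i + l + 1), S.q i ^ S.r j := by
  induction l with
  | zero => simp [size]
  | succ l ih =>
    rw [size, ih, mul_comm]
    exact (Finset.prod_Ico_succ_top (by omega) _).symm

/-- The `i`-th block at stage `n = i + l + 1`: matrices of size `[n, i]` over the folding interval
algebra of level `n - i = l + 1`. -/
abbrev Block (i l : ℕ) : Type :=
  CStarMatrix (Fin (S.size i l)) (Fin (S.size i l)) (FoldAlg (S.bd i) l)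

/-- The `s`-th diagonal entry of the partial map between the `i`-th blocks at the stages
`n = i + l + 1` and `n + 1`: the folding map for `s = 0`, and the evaluation at
`s / q_i ^ r_n` for `0 < s < q_i ^ r_n`. -/
def entry (i l : ℕ) (s : Fin (S.q i ^ S.r (i + l + 1))) :
    FoldAlg (S.bd i) l →⋆ₐ[ℂ] FoldAlg (S.bd i) (l + 1) :=
  if (s : ℕ) = 0 then FoldAlg.fold (S.he i) (S.bd i) l
  else FoldAlg.pointEval (S.bd i)
    ⟨(s : ℝ) / (S.q i ^ S.r (i + l + 1) : ℕ), by positivity,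
      div_le_one_of_le₀ (by exact_mod_cast s.2.le) (by positivity)⟩ l

/-- The partial map between the `i`-th blocks at the stages `i + l + 1` and `i + l + 2`. -/
def blockMap (i l : ℕ) : S.Block i l →⋆ₐ[ℂ] S.Block i (l + 1) := diagHom (S.entry i l)

/-- The folding blocks at stage `n` are indexed by the pairs `(i, l)` with `i + l + 1 = n`, that
is, `0 ≤ i < n` and `l + 1 = n - i`. -/
abbrev Idx (n : ℕ) : Type := {p : ℕ × ℕ // p.1 + p.2 + 1 = n}

instance (n : ℕ) : Fintype (Idx n) :=
  Fintype.subtype ((Finset.range n ×ˢ Finset.range n).filter fun p => p.1 + p.2 + 1 = n)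
    (by rintro ⟨i, l⟩; simp; omega)

/-- The `n`-th algebra: the direct sum of the blocks `0 ≤ i < n` and of `C([0,1])`. -/
abbrev Stage (n : ℕ) : Type := (∀ p : Idx n, S.Block p.1.1 p.1.2) × C(I, ℂ)

/-- The component of the connecting map in the folding block `p` of stage `n + 1`: from the
corresponding block of stage `n` if there is one, and `f ↦ f(0) 1` on `C([0,1])` for the new
block. -/
def toBlock (n : ℕ) : ∀ p : Idx (n + 1), S.Stage n →⋆ₐ[ℂ] S.Block p.1.1 p.1.2
  | ⟨(i, 0), _⟩ =>
    ((StarAlgHom.ofId ℂ (S.Block i 0)).comp (ContinuousMap.evalStarAlgHom ℂ ℂ (0 : I))).comp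
      (StarAlgHom.snd ℂ (∀ p : Idx n, S.Block p.1.1 p.1.2) C(I, ℂ))
  | ⟨(i, l + 1), h⟩ =>
    ((S.blockMap i l).comp (Pi.evalStarAlgHom ℂ (fun p : Idx n => S.Block p.1.1 p.1.2)
      ⟨(i, l), Nat.succ_injective h⟩)).comp
      (StarAlgHom.fst ℂ (∀ p : Idx n, S.Block p.1.1 p.1.2) C(I, ℂ))

/-- The connecting map from stage `n` to stage `n + 1`; on the summand `C([0,1])` of the target it
is `f ↦ f(d n)`. -/
def stageMap (n : ℕ) : S.Stage n →⋆ₐ[ℂ] S.Stage (n + 1) where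
  toFun x := (fun p => S.toBlock n p x, algebraMap ℂ C(I, ℂ) (x.2 (S.d n)))
  map_one' := by ext <;> simp
  map_mul' x y := by ext <;> simp
  map_zero' := by ext <;> simp
  map_add' x y := by ext <;> simp
  commutes' c := by
    refine Prod.ext (funext fun p => AlgHomClass.commutes (S.toBlock n p) c) ?_
    ext t; simp
  map_star' x := by
    refine Prod.ext (funext fun p => map_star (S.toBlock n p) x) ?_
    ext t; simp

/-- The inductive limit C⋆-algebra of the sequence. -/
abbrev Alg : Type := CStarLimit.Limit S.stageMap

/-- The `i`-th block `I_{n,i}` of stage `n`, as a subspace of that stage. -/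
def block (n i : ℕ) : Submodule ℂ (S.Stage n) where
  carrier := {x | (∀ p : Idx n, p.1.1 ≠ i → x.1 p = 0) ∧ x.2 = 0}
  add_mem' hx hy := ⟨fun p hp => by simp [hx.1 p hp, hy.1 p hp], by simp [hx.2, hy.2]⟩
  zero_mem' := ⟨fun _ _ => rfl, rfl⟩
  smul_mem' c x hx := ⟨fun p hp => by simp [hx.1 p hp], by simp [hx.2]⟩

/-- The sum of all blocks of stage `n` other than the `i`-th one, and of `C([0,1])`. -/
def coblock (n i : ℕ) : Submodule ℂ (S.Stage n) where
  carrier := {x | ∀ p : Idx n, p.1.1 = i → x.1 p = 0}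
  add_mem' hx hy := fun p hp => by simp [hx p hp, hy p hp]
  zero_mem' := fun _ _ => rfl
  smul_mem' c x hx := fun p hp => by simp [hx p hp]

/-- The inductive limit over the stages `n > i` of subspaces `V n` of the stages, inside the limit
algebra: the closure of the union of their images. -/
def limitOf (i : ℕ) (V : ∀ n, Submodule ℂ (S.Stage n)) : Submodule ℂ S.Alg :=
  (⨆ n, ⨆ _ : i < n, (V n).map
    (CStarLimit.toLimit S.stageMap n).toAlgHom.toLinearMap).topologicalClosure

/-- The limit of the `i`-th blocks. -/
def blockLimit (i : ℕ) : Submodule ℂ S.Alg := S.limitOf i fun n => S.block n i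

/-- The limit of the complements of the `i`-th blocks. -/
def coblockLimit (i : ℕ) : Submodule ℂ S.Alg := S.limitOf i fun n => S.coblock n i

/-- The (C⋆-algebraic) direct sum of all block limits: the closure of their sum. -/
def blockSum : Submodule ℂ S.Alg := (⨆ i, S.blockLimit i).topologicalClosure

end BlockSystem

section ideals

variable {A : Type*} [CStarAlgebra A]

/-- `J` is a closed two-sided ideal of the subalgebra `K`. -/
structure IsClosedIdealOf (J K : Submodule ℂ A) : Prop where
  le : J ≤ K
  isClosed : IsClosed (J : Set A)
  mul_mem_left : ∀ x ∈ K, ∀ y ∈ J, x * y ∈ J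
  mul_mem_right : ∀ x ∈ K, ∀ y ∈ J, y * x ∈ J

/-- `J` is a closed two-sided ideal of the C⋆-algebra. -/
def IsClosedIdeal (J : Submodule ℂ A) : Prop := IsClosedIdealOf J ⊤

/-- `J` is a closed two-sided ideal that is simple as a C⋆-algebra: it is nonzero, and its only
closed two-sided ideals are zero and `J`. -/
structure IsSimpleIdeal (J : Submodule ℂ A) : Prop where
  isClosedIdeal : IsClosedIdeal J
  ne_bot : J ≠ ⊥
  eq_bot_or_eq : ∀ K : Submodule ℂ A, IsClosedIdealOf K J → K = ⊥ ∨ K = J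

/-- The quotient of `A` by the closed ideal `J` is isomorphic to the C⋆-algebra `B`: there is a
linear bijection `A ⧸ J → B` that is multiplicative, `*`-preserving and isometric for the operations
and the norm of the quotient. -/
structure QuotientIso (J : Submodule ℂ A) (B : Type*) [CStarAlgebra B] where
  toLinearEquiv : (A ⧸ J) ≃ₗ[ℂ] B
  isClosedIdeal : IsClosedIdeal J
  map_mul : ∀ x y, toLinearEquiv (J.mkQ (x * y)) = toLinearEquiv (J.mkQ x) * toLinearEquiv (J.mkQ y)
  map_star : ∀ x, toLinearEquiv (J.mkQ (star x)) = star (toLinearEquiv (J.mkQ x))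
  norm_map : ∀ z, ‖toLinearEquiv z‖ = ‖z‖

end ideals

/-- The primes in increasing order: `p 0 = 2`, `p 1 = 3`, …. -/
def primeSeq (k : ℕ) : ℕ := Nat.nth Nat.Prime k

/-- The preceding prime `p (k - 1)`, where `p (-1) = 1`. -/
def prevPrime : ℕ → ℕ
  | 0 => 1
  | k + 1 => primeSeq k

/-- The sizes `q k = p k * p (k - 1)`. -/
def sizeSeq (k : ℕ) : ℕ := primeSeq k * prevPrime k

end

/-! The unit of the i-th block is preserved by the connecting maps and gives a central projection
p_i (`unit i`) of the limit; distinct p_i are orthogonal. Then s_i = p_i A and a_i = (1 - p_i) A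
(`mem_blockLimit_iff`, `mem_coblockLimit_iff`), whence the splitting and the independence.

Simplicity of s_i: let K be a closed ideal of s_i with p_i not in K. If K were nonzero, functional
calculus would put a nonzero element of a finite stage into K (`exists_toLimit_mem`), and
compression by matrix units reduces to a matrix with a single entry f. If f were nonzero at an
evaluation point, the next stage would show a twisted copy of a nonzero scalar matrix, and
simplicity of matrix algebras would give p_i in K. So f vanishes at all evaluation points, and its
image at the next stage is again a single entry, the folding of f. Folding doubles the scale on
which an oscillation bound holds; after finitely many steps the bound holds on the whole interval,
and together with one zero it bounds the norm. By uniform continuity the bound can be taken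
arbitrarily small, so f dies in the limit (`norm_embed_entryAt_le`, `embed_eq_zero`).

For the rest, one connecting map turns the C([0,1]) component into a scalar c. So an element of a
stage is c plus a part in finitely many blocks, and the next block to appear receives exactly c
(`exists_near`). Hence A is the closed sum of the s_i plus the scalars. An element of the algebraic
sum is killed by p_N for large N, so it has distance at least 1 from the unit, and the quotient is
the complex numbers. If all p_i kill x, then c is small for good approximants and x = 0
(`eq_zero_of_unit_mul`); so a simple ideal meets some s_i and must equal it
(`setOf_isSimpleIdeal_eq`). -/

noncomputable section

/-! ### Closed ideals of a C⋆-algebra. -/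

section general

variable {A : Type*} [CStarAlgebra A]

/-- If the self-adjoint element `a` has distance less than `c` from the ideal `K`, then `K` contains
`(|a| - c)₊`. -/
lemma IsClosedIdeal.cfc_mem {K : Submodule ℂ A} (hK : IsClosedIdeal K) {a k : A}
    (ha : IsSelfAdjoint a) (hk : k ∈ K) {c : ℝ} (hc : 0 < c) (hak : ‖a - k‖ < c) :
    cfc (fun t : ℝ => max |t| c - c) a ∈ K := by
  have hpos : ∀ t : ℝ, 0 < max |t| c := fun t => lt_max_of_lt_right hc
  have hcont : Continuous fun t : ℝ => t / (max |t| c) ^ 2 :=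
    continuous_id.div (by fun_prop) fun t => (pow_pos (hpos t) 2).ne'
  set p := cfc (fun t : ℝ => max |t| c - c) a with hp
  -- `h` inverts `a` where `p` is supported, and `‖h‖ ≤ 1 / c` makes `1 - (a - k) * h` invertible.
  -- As `p * (1 - (a - k) * h) = p * (k * h)` lies in `K`, so does `p`; no quotient algebra is
  -- needed.
  set h := cfc (fun t : ℝ => t / (max |t| c) ^ 2) a with hh
  have hpa : p * (a * h) = p := by
    have e : a * h = cfc (fun t : ℝ => t * (t / (max |t| c) ^ 2)) a := by
      rw [cfc_mul (fun t : ℝ => t) _ a (by fun_prop) hcont.continuousOn, cfc_id' ℝ a]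
    rw [e, hp, ← cfc_mul (fun t : ℝ => max |t| c - c) (fun t : ℝ => t * (t / (max |t| c) ^ 2)) a
      (by fun_prop) (continuous_id.mul hcont).continuousOn]
    refine congrArg (fun f : ℝ → ℝ => cfc f a) (funext fun t => ?_)
    rcases le_total |t| c with ht | ht
    · simp [max_eq_right ht]
    · have h0 : |t| ≠ 0 := (hc.trans_le ht).ne'
      rw [max_eq_left ht]
      field_simp
      rw [sq_abs, mul_comm]
  have hh1 : ‖h‖ ≤ 1 / c := by
    refine norm_cfc_le (by positivity) fun t _ => ?_
    rw [Real.norm_eq_abs, abs_div, abs_of_pos (pow_pos (hpos t) 2), div_le_div_iff₀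
      (pow_pos (hpos t) 2) hc, one_mul, sq]
    exact mul_le_mul (le_max_left _ _) (le_max_right _ _) hc.le (hpos t).le
  have hd : ‖(a - k) * h‖ < 1 := by
    calc _ ≤ ‖a - k‖ * ‖h‖ := norm_mul_le _ _
      _ ≤ ‖a - k‖ * (1 / c) := by gcongr
      _ < 1 := by rw [mul_one_div, div_lt_one hc]; exact hak
  have hU := (Units.oneSub _ hd).mul_inv
  rw [Units.val_oneSub] at hU
  have hmem : p * (1 - (a - k) * h) ∈ K := by
    have e : p * (1 - (a - k) * h) = p * (k * h) := by
      calc p * (1 - (a - k) * h) = p - p * (a * h) + p * (k * h) := by noncomm_ring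
        _ = _ := by rw [hpa, sub_self, zero_add]
    rw [e]
    exact hK.mul_mem_left _ trivial _ (hK.mul_mem_right _ trivial _ hk)
  have := hK.mul_mem_right (↑(Units.oneSub _ hd)⁻¹) trivial _ hmem
  rwa [mul_assoc, hU, mul_one] at this

/-- The function vanishes on the spectrum of `a`, which therefore lies in `[-c, c]`. -/
lemma norm_le_of_cfc_eq_zero {a : A} (ha : IsSelfAdjoint a) {c : ℝ} (hc : 0 ≤ c)
    (h : cfc (fun t : ℝ => max |t| c - c) a = 0) : ‖a‖ ≤ c := by
  rw [← cfc_id' ℝ a]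
  refine norm_cfc_le hc fun t ht => ?_
  have h1 := norm_apply_le_norm_cfc (fun t : ℝ => max |t| c - c) a ht (by fun_prop) ha
  rw [h, norm_zero, norm_le_zero_iff, sub_eq_zero] at h1
  exact max_eq_right_iff.1 h1

/-- A closed ideal that does not contain `1` and spans the algebra together with `1` has
quotient `ℂ`. -/
lemma nonempty_quotientIso {J : Submodule ℂ A} (hJ : IsClosedIdeal J) (h1 : (1 : A) ∉ J)
    (hstar : ∀ y ∈ J, star y ∈ J) (h : ∀ x : A, ∃ c : ℂ, x - algebraMap ℂ A c ∈ J) :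
    Nonempty (QuotientIso J ℂ) := by
  let f : ℂ →ₗ[ℂ] A ⧸ J := J.mkQ ∘ₗ Algebra.linearMap ℂ A
  have hf : ∀ c, f c = J.mkQ (algebraMap ℂ A c) := fun _ => rfl
  have hfJ : ∀ {c x}, x - algebraMap ℂ A c ∈ J → J.mkQ x = f c := fun h =>
    (Submodule.Quotient.eq J).2 h
  have hinj : Function.Injective f := by
    rw [injective_iff_map_eq_zero]
    intro c hc
    by_contra hc0
    rw [hf, Submodule.mkQ_apply, Submodule.Quotient.mk_eq_zero] at hc
    refine h1 ?_
    have := J.smul_mem c⁻¹ hc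
    rwa [Algebra.algebraMap_eq_smul_one, smul_smul, inv_mul_cancel₀ hc0, one_smul] at this
  have hsurj : Function.Surjective f := by
    intro z
    obtain ⟨x, rfl⟩ := J.mkQ_surjective z
    obtain ⟨c, hc⟩ := h x
    exact ⟨c, (hfJ hc).symm⟩
  let g := LinearEquiv.ofBijective f ⟨hinj, hsurj⟩
  have hg : ∀ {c x}, x - algebraMap ℂ A c ∈ J → g.symm (J.mkQ x) = c := fun h => by
    rw [LinearEquiv.symm_apply_eq]; exact hfJ h
  have : Nontrivial A := ⟨⟨1, 0, fun e => h1 (e ▸ J.zero_mem)⟩⟩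
  refine ⟨⟨g.symm, hJ, fun x y => ?_, fun x => ?_, fun z => ?_⟩⟩
  · obtain ⟨c, hc⟩ := h x
    obtain ⟨c', hc'⟩ := h y
    rw [hg hc, hg hc']
    refine hg ?_
    have : x * y - algebraMap ℂ A (c * c') =
        x * (y - algebraMap ℂ A c') + (x - algebraMap ℂ A c) * algebraMap ℂ A c' := by
      rw [map_mul]; noncomm_ring
    rw [this]
    exact J.add_mem (hJ.mul_mem_left _ trivial _ hc') (hJ.mul_mem_right _ trivial _ hc)
  · obtain ⟨c, hc⟩ := h x
    rw [hg hc]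
    refine hg ?_
    have := hstar _ hc
    rwa [star_sub, ← algebraMap_star_comm] at this
  · obtain ⟨c, rfl⟩ := g.surjective z
    rw [LinearEquiv.symm_apply_apply]
    change ‖c‖ = ‖f c‖
    refine le_antisymm ?_ ?_
    · rw [hf]
      refine le_of_forall_pos_lt_add fun ε hε => ?_
      by_contra hlt
      push Not at hlt
      have hlt' : ‖J.mkQ (algebraMap ℂ A c)‖ < ‖c‖ := by linarith
      have hc0 : c ≠ 0 := by
        rintro rfl
        rw [norm_zero] at hlt'
        exact absurd (norm_nonneg _) hlt'.not_ge
      -- A representative `m` of the class of `c` with `‖m‖ < ‖c‖` would make `1 - c⁻¹ • m` an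
      -- invertible element of `J`.
      obtain ⟨m, hm, hmc⟩ := (QuotientAddGroup.norm_lt_iff (S := J.toAddSubgroup)).1 hlt'
      have hm' : m - algebraMap ℂ A c ∈ J := (Submodule.Quotient.eq J).1 hm
      have hd : ‖c⁻¹ • m‖ < 1 := by
        rw [norm_smul, norm_inv, inv_mul_lt_iff₀ (norm_pos_iff.2 hc0), mul_one]
        exact hmc
      have hU := (Units.oneSub _ hd).mul_inv
      rw [Units.val_oneSub] at hU
      have hmem : 1 - c⁻¹ • m ∈ J := by
        have e := J.smul_mem (-c⁻¹) hm'
        have : -c⁻¹ • (m - algebraMap ℂ A c) = 1 - c⁻¹ • m := by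
          rw [Algebra.algebraMap_eq_smul_one, smul_sub, smul_smul, neg_mul, inv_mul_cancel₀ hc0]
          module
        rwa [this] at e
      refine h1 ?_
      rw [← hU]
      exact hJ.mul_mem_right _ trivial _ hmem
    · rw [hf]
      refine (Submodule.Quotient.norm_mk_le J _).trans ?_
      rw [Algebra.algebraMap_eq_smul_one, norm_smul]
      exact mul_le_of_le_one_right (norm_nonneg _) (CStarRing.norm_of_mem_unitary (one_mem (unitary A))).le

lemma iSupIndep_of_disjoint {s a : ℕ → Submodule ℂ A} (h : ∀ i, Disjoint (a i) (s i))
    (hle : ∀ i j, i ≠ j → s j ≤ a i) : iSupIndep s := fun i =>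
  ((h i).mono_left (iSup₂_le fun j hj => hle i j hj.symm)).symm

/-- Insert the unit: `x * y = (x * p) * y`, and `x * p` lies in `J`. -/
lemma IsClosedIdealOf.trans_of_unit {K J : Submodule ℂ A} (hK : IsClosedIdealOf K J)
    (hJ : IsClosedIdeal J) {p : A} (hp : p ∈ J) (hpJ : ∀ x ∈ J, p * x = x ∧ x * p = x) :
    IsClosedIdeal K where
  le := le_top
  isClosed := hK.isClosed
  mul_mem_left x _ y hy := by
    rw [← (hpJ y (hK.le hy)).1, ← mul_assoc]
    exact hK.mul_mem_left _ (hJ.mul_mem_left _ trivial _ hp) _ hy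
  mul_mem_right x _ y hy := by
    rw [← (hpJ y (hK.le hy)).2, mul_assoc]
    exact hK.mul_mem_right _ (hJ.mul_mem_right _ trivial _ hp) _ hy

/-- If simple ideals `s i` with units `p i` have no common annihilator, then there are no other
simple ideals. -/
lemma setOf_isSimpleIdeal_eq {s : ℕ → Submodule ℂ A} (hs : ∀ i, IsSimpleIdeal (s i)) {p : ℕ → A}
    (hp : ∀ i, p i ∈ s i) (h0 : ∀ x, (∀ i, p i * x = 0) → x = 0) :
    {J : Submodule ℂ A | IsSimpleIdeal J} = Set.range s := by
  refine Set.Subset.antisymm (fun J hJ => ?_) (Set.range_subset_iff.2 hs)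
  have hJi := hJ.isClosedIdeal
  have hinf : ∀ i, IsClosedIdealOf (J ⊓ s i) J ∧ IsClosedIdealOf (J ⊓ s i) (s i) := by
    intro i
    have hsi := (hs i).isClosedIdeal
    have hc : IsClosed ((J ⊓ s i : Submodule ℂ A) : Set A) := hJi.isClosed.inter hsi.isClosed
    have hl : ∀ x, ∀ y ∈ J ⊓ s i, x * y ∈ J ⊓ s i := fun x y hy =>
      ⟨hJi.mul_mem_left _ trivial _ hy.1, hsi.mul_mem_left _ trivial _ hy.2⟩
    have hr : ∀ x, ∀ y ∈ J ⊓ s i, y * x ∈ J ⊓ s i := fun x y hy =>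
      ⟨hJi.mul_mem_right _ trivial _ hy.1, hsi.mul_mem_right _ trivial _ hy.2⟩
    exact ⟨⟨inf_le_left, hc, fun x _ => hl x, fun x _ => hr x⟩,
      ⟨inf_le_right, hc, fun x _ => hl x, fun x _ => hr x⟩⟩
  by_contra hne
  refine hJ.ne_bot (J.eq_bot_iff.2 fun x hx => h0 x fun i => ?_)
  -- `J ⊓ s i` is an ideal of two simple algebras: either it is zero and so is its element `p i *
  -- x`, or it equals both `J` and `s i`.
  rcases hJ.eq_bot_or_eq _ (hinf i).1 with h | h
  · have : p i * x ∈ J ⊓ s i :=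
      ⟨hJi.mul_mem_left _ trivial _ hx, (hs i).isClosedIdeal.mul_mem_right _ trivial _ (hp i)⟩
    rwa [h] at this
  · rcases (hs i).eq_bot_or_eq _ (hinf i).2 with h' | h'
    · exact absurd (h.symm.trans h') hJ.ne_bot
    · exact absurd ⟨i, h'.symm.trans h⟩ hne

end general

/-! ### Matrices with a single entry. -/

section matrix

variable {R : Type} [CStarAlgebra R] {n : Type} [DecidableEq n]

/-- The matrix with the only entry `f` at `(a, b)`. -/
def CStarMatrix.entryAt (a b : n) (f : R) : CStarMatrix n n R :=
  CStarMatrix.ofMatrix (Matrix.single a b f)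

namespace CStarMatrix

lemma entryAt_apply (a b : n) (f : R) (i j : n) :
    entryAt a b f i j = if a = i ∧ b = j then f else 0 := rfl

lemma entryAt_zero (a b : n) : entryAt a b (0 : R) = 0 := Matrix.single_zero a b

lemma entryAt_add (a b : n) (f g : R) : entryAt a b (f + g) = entryAt a b f + entryAt a b g :=
  Matrix.single_add a b f g

lemma star_entryAt (a b : n) (f : R) : star (entryAt a b f) = entryAt b a (star f) :=
  Matrix.conjTranspose_single a b f

variable [Fintype n]

lemma entryAt_mul (a b c : n) (f g : R) :
    entryAt a b f * entryAt b c g = entryAt a c (f * g) := Matrix.single_mul_single_same ..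

lemma entryAt_mul_mul (p a b r : n) (f g : R) (x : CStarMatrix n n R) :
    entryAt p a f * x * entryAt b r g = entryAt p r (f * x a b * g) :=
  Matrix.single_mul_mul_single p a b r f (ofMatrix.symm x) g

lemma sum_entryAt (x : CStarMatrix n n R) : ∑ a, ∑ b, entryAt a b (x a b) = x :=
  (Matrix.matrix_eq_sum_single (ofMatrix.symm x)).symm

lemma sum_entryAt_one : ∑ a, entryAt a a (1 : R) = (1 : CStarMatrix n n R) :=
  Matrix.sum_single_one

/-- The inclusion of a diagonal corner in the algebra of matrices. -/
def diagEntry (b : n) : R →⋆ₙₐ[ℂ] CStarMatrix n n R where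
  toFun := entryAt b b
  map_smul' c f := (Matrix.smul_single c b b f).symm
  map_zero' := entryAt_zero b b
  map_add' := entryAt_add b b
  map_mul' f g := (entryAt_mul b b b f g).symm
  map_star' f := (star_entryAt b b f).symm

variable [PartialOrder R] [StarOrderedRing R]

/-- The C⋆-identity reduces to a diagonal position, where the corner inclusion is a `*`-homomorphism
and hence contractive. -/
lemma norm_entryAt_le (a b : n) (f : R) : ‖entryAt a b f‖ ≤ ‖f‖ := by
  have h : ‖star (entryAt a b f) * entryAt a b f‖ ≤ ‖star f * f‖ := by
    rw [star_entryAt, entryAt_mul]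
    exact NonUnitalStarAlgHom.norm_apply_le (diagEntry (n := n) b) _
  rw [CStarRing.norm_star_mul_self, CStarRing.norm_star_mul_self] at h
  exact (mul_self_le_mul_self_iff (norm_nonneg _) (norm_nonneg _)).2 h

end CStarMatrix

/-- An additive subgroup of a matrix algebra that is stable under multiplications contains `1` if
it contains a matrix with an entry that is the image of a nonzero scalar matrix. -/
lemma one_mem_of_entry [Fintype n] {N : Type} [Fintype N] [DecidableEq N]
    (κ : Matrix N N ℂ →⋆ₐ[ℂ] R) {v : Matrix N N ℂ} (hv : v ≠ 0)
    (L : AddSubgroup (CStarMatrix n n R)) (hl : ∀ x, ∀ y ∈ L, x * y ∈ L)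
    (hr : ∀ x, ∀ y ∈ L, y * x ∈ L) {x : CStarMatrix n n R} (hx : x ∈ L) {p q : n}
    (hpq : x p q = κ v) : 1 ∈ L := by
  obtain ⟨c, d, hcd⟩ : ∃ c d, v c d ≠ 0 := by
    by_contra! h
    exact hv (Matrix.ext h)
  -- Simplicity of the matrix algebra made explicit: matrix units carry the entry `v c d` to each
  -- diagonal position.
  have h1 : (1 : Matrix N N ℂ) =
      ∑ j, Matrix.single j c 1 * v * Matrix.single d j (v c d)⁻¹ := by
    simp only [Matrix.single_mul_mul_single, one_mul, mul_inv_cancel₀ hcd]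
    exact Matrix.sum_single_one.symm
  rw [← CStarMatrix.sum_entryAt_one]
  refine sum_mem fun r _ => ?_
  rw [← map_one κ, h1, map_sum, show CStarMatrix.entryAt r r = CStarMatrix.diagEntry r from rfl,
    map_sum]
  refine sum_mem fun j _ => ?_
  rw [map_mul κ, map_mul κ, ← hpq]
  change CStarMatrix.entryAt r r _ ∈ L
  have := CStarMatrix.entryAt_mul_mul r p q r (κ (Matrix.single j c 1))
    (κ (Matrix.single d j (v c d)⁻¹)) x
  exact this ▸ hr _ _ (hl _ _ hx)

end matrix

/-! ### Closed ideals of inductive limits. -/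

namespace CStarLimit

variable {X : ℕ → Type*} [∀ n, CStarAlgebra (X n)] (φ : ∀ n, X n →⋆ₐ[ℂ] X (n + 1))

lemma toLimit_trans {n m : ℕ} (h : n ≤ m) (x : X n) :
    toLimit φ m (trans φ h x) = toLimit φ n x := by
  induction m, h using Nat.le_induction with
  | base => rw [trans_self]
  | succ m hm ih => rw [trans_succ φ hm, toLimit_comp, ih]

lemma exists_toLimit_norm_sub_lt (N : ℕ) (x : Limit φ) {ε : ℝ} (hε : 0 < ε) :
    ∃ n, N ≤ n ∧ ∃ z : X n, ‖x - toLimit φ n z‖ < ε := by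
  obtain ⟨y, hy, hxy⟩ := Metric.mem_closure_iff.1 (dense_iUnion_range_toLimit φ x) ε hε
  obtain ⟨n, z, rfl⟩ := Set.mem_iUnion.1 hy
  refine ⟨max N n, le_max_left _ _, trans φ (le_max_right N n) z, ?_⟩
  rwa [toLimit_trans, ← dist_eq_norm]

/-- A nonzero closed ideal of an inductive limit contains a nonzero element of some stage. -/
lemma exists_toLimit_mem {K : Submodule ℂ (Limit φ)} (hK : IsClosedIdeal K) (hK0 : K ≠ ⊥) (N : ℕ) :
    ∃ n, N ≤ n ∧ ∃ y : X n, toLimit φ n y ∈ K ∧ toLimit φ n y ≠ 0 := by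
  obtain ⟨x, hx, hx0⟩ := K.ne_bot_iff.1 hK0
  have hpos : 0 < ‖star x * x‖ := by
    rw [CStarRing.norm_star_mul_self]; exact mul_self_pos.2 (norm_ne_zero_iff.2 hx0)
  set k := star x * x with hk
  have hkK : k ∈ K := hK.mul_mem_left _ trivial _ hx
  have hks : IsSelfAdjoint k := .star_mul_self x
  -- The tolerance `‖k‖ / 2` serves twice: cutting off `a` at this level gives an element of `K`,
  -- and the result is nonzero because `‖a‖ > ‖k‖ / 2`.
  obtain ⟨n, hn, z, hz⟩ := exists_toLimit_norm_sub_lt φ N k (half_pos hpos)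
  have hre : (selfAdjointPart ℝ z : X n) = (2⁻¹ : ℝ) • (z + star z) := by
    simp [selfAdjointPart_apply_coe]
  set w : X n := (selfAdjointPart ℝ z : X n) with hw
  have hws : IsSelfAdjoint w := (selfAdjointPart ℝ z).2
  set a := toLimit φ n w with ha
  have has : IsSelfAdjoint a := hws.map _
  have hak : ‖a - k‖ < ‖k‖ / 2 := by
    -- Since `k` is self-adjoint, replacing `z` by its self-adjoint part does not increase the
    -- distance to `k`.
    have e : k - a = (2⁻¹ : ℝ) • ((k - toLimit φ n z) + star (k - toLimit φ n z)) := by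
      have : a = (2⁻¹ : ℝ) • (toLimit φ n z + star (toLimit φ n z)) := by
        rw [ha, hre, ← map_star, ← map_add]
        exact map_smul (toLimit φ n) ((2⁻¹ : ℝ) : ℂ) _
      rw [this, star_sub, hks.star_eq]
      module
    rw [norm_sub_rev, e, norm_smul]
    have h1 := norm_add_le (k - toLimit φ n z) (star (k - toLimit φ n z))
    rw [norm_star] at h1
    rw [Real.norm_of_nonneg (by norm_num)]
    linarith
  -- Functional calculus commutes with `*`-homomorphisms, so the cut-off comes from stage `n`.
  have hmap : toLimit φ n (cfc (fun t : ℝ => max |t| (‖k‖ / 2) - ‖k‖ / 2) w) =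
      cfc (fun t : ℝ => max |t| (‖k‖ / 2) - ‖k‖ / 2) a :=
    StarAlgHomClass.map_cfc (toLimit φ n) _ w (by fun_prop)
      ((AddMonoidHomClass.lipschitz_of_bound (toLimit φ n) 1 fun x => by
        rw [one_mul]; exact NonUnitalStarAlgHom.norm_apply_le _ x).continuous) hws has
  refine ⟨n, hn, cfc (fun t : ℝ => max |t| (‖k‖ / 2) - ‖k‖ / 2) w, ?_, ?_⟩
  · rw [hmap]
    exact hK.cfc_mem has hkK (half_pos hpos) hak
  · rw [hmap]
    intro h0
    have h1 := norm_le_of_cfc_eq_zero has (half_pos hpos).le h0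
    have h2 := norm_sub_norm_le k a
    rw [norm_sub_rev] at h2
    linarith

end CStarLimit

/-! ### The central projections of the blocks and the splitting of the limit. -/

namespace BlockSystem

open CStarLimit Folding

variable (S : BlockSystem)

/-- The unit of the `i`-th block of stage `n`. -/
def unitAt (n i : ℕ) : S.Stage n := (fun p => if p.1.1 = i then 1 else 0, 0)

variable {S}

lemma unitAt_fst (n i : ℕ) (p : Idx n) : (S.unitAt n i).1 p = if p.1.1 = i then 1 else 0 := rfl

lemma unitAt_mul (n i : ℕ) (x : S.Stage n) :
    S.unitAt n i * x = (fun p => if p.1.1 = i then x.1 p else 0, 0) := by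
  refine Prod.ext (funext fun p => ?_) (zero_mul _)
  change (if p.1.1 = i then 1 else 0) * x.1 p = _
  rw [ite_mul, one_mul, zero_mul]

lemma mul_unitAt (n i : ℕ) (x : S.Stage n) :
    x * S.unitAt n i = (fun p => if p.1.1 = i then x.1 p else 0, 0) := by
  refine Prod.ext (funext fun p => ?_) (mul_zero _)
  change x.1 p * (if p.1.1 = i then 1 else 0) = _
  rw [mul_ite, mul_one, mul_zero]

lemma unitAt_mul_mem_block (n i : ℕ) (x : S.Stage n) : S.unitAt n i * x ∈ S.block n i := by
  rw [unitAt_mul]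
  exact ⟨fun p hp => if_neg hp, rfl⟩

lemma mem_block_iff {n i : ℕ} {x : S.Stage n} : x ∈ S.block n i ↔ S.unitAt n i * x = x := by
  refine ⟨fun h => ?_, fun h => h ▸ unitAt_mul_mem_block n i x⟩
  rw [unitAt_mul]
  refine Prod.ext (funext fun p => ?_) h.2.symm
  change (if _ then _ else _) = _
  split_ifs with hp
  · rfl
  · exact (h.1 p hp).symm

lemma mem_coblock_iff {n i : ℕ} {x : S.Stage n} : x ∈ S.coblock n i ↔ S.unitAt n i * x = 0 := by
  rw [unitAt_mul]
  constructor
  · intro h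
    refine Prod.ext (funext fun p => ?_) rfl
    change (if _ then _ else _) = _
    split_ifs with hp
    · exact h p hp
    · rfl
  · intro h p hp
    have := congrFun (congrArg Prod.fst h) p
    change (if _ then _ else _) = _ at this
    rwa [if_pos hp] at this

/-- The block maps are unital, and the block created at stage `n + 1` only sees the `C([0,1])`
component, which is zero. That block has index `n`, so `i < n` keeps it apart from block `i`. -/
lemma stageMap_unitAt {n i : ℕ} (h : i < n) :
    S.stageMap n (S.unitAt n i) = S.unitAt (n + 1) i := by
  refine Prod.ext (funext fun p => ?_) (map_zero _)
  obtain ⟨⟨j, l⟩, hp⟩ := p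
  cases l with
  | zero =>
    change StarAlgHom.ofId ℂ (S.Block j 0) 0 = if j = i then 1 else 0
    have hp' : j + 0 + 1 = n + 1 := hp
    rw [map_zero, if_neg (by omega)]
  | succ l =>
    change S.blockMap j l (if j = i then 1 else 0) = if j = i then 1 else 0
    split_ifs
    · exact map_one _
    · exact map_zero _

variable (S) in
/-- The unit of the limit of the `i`-th blocks. -/
def unit (i : ℕ) : S.Alg := toLimit S.stageMap (i + 1) (S.unitAt (i + 1) i)

lemma toLimit_unitAt {n i : ℕ} (h : i < n) :
    toLimit S.stageMap n (S.unitAt n i) = S.unit i := by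
  induction n, h using Nat.le_induction with
  | base => rfl
  | succ m hm ih => rw [← stageMap_unitAt hm, toLimit_comp, ih]

/-- The bound `N` allows identities for `unit i` to be checked only at stages `n > i`, where `unit
i` is the image of `unitAt n i`. -/
lemma dense_stages (N : ℕ) :
    Dense {y : S.Alg | ∃ n, N ≤ n ∧ ∃ z, toLimit S.stageMap n z = y} := fun x =>
  Metric.mem_closure_iff.2 fun ε hε => by
    obtain ⟨n, hn, z, hz⟩ := exists_toLimit_norm_sub_lt S.stageMap N x hε
    exact ⟨_, ⟨n, hn, z, rfl⟩, by rwa [dist_eq_norm]⟩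

lemma eq_of_dense_stages {f g : S.Alg → S.Alg} (hf : Continuous f) (hg : Continuous g) (N : ℕ)
    (h : ∀ n, N ≤ n → ∀ z, f (toLimit S.stageMap n z) = g (toLimit S.stageMap n z)) (x : S.Alg) :
    f x = g x := by
  refine congrFun (hf.ext_on (dense_stages N) hg ?_) x
  rintro _ ⟨n, hn, z, rfl⟩
  exact h n hn z

lemma unit_mul_comm (i : ℕ) (x : S.Alg) : S.unit i * x = x * S.unit i := by
  refine eq_of_dense_stages (continuous_const_mul (S.unit i)) (continuous_mul_const (S.unit i)) (i + 1)
    (fun n hn z => ?_) x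
  rw [← toLimit_unitAt hn, ← map_mul, ← map_mul, unitAt_mul, mul_unitAt]

lemma unit_mul_self (i : ℕ) : S.unit i * S.unit i = S.unit i := by
  rw [unit, ← map_mul, mem_block_iff.1 ⟨fun p hp => if_neg hp, rfl⟩]

lemma unit_mul_unit {i j : ℕ} (h : i ≠ j) : S.unit i * S.unit j = 0 := by
  have hi : i < max i j + 1 := by omega
  have hj : j < max i j + 1 := by omega
  rw [← toLimit_unitAt hi, ← toLimit_unitAt hj, ← map_mul, mem_coblock_iff.1, map_zero]
  exact fun p hp => if_neg (by omega)

lemma star_unitAt (n i : ℕ) : star (S.unitAt n i) = S.unitAt n i := by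
  refine Prod.ext (funext fun p => ?_) (star_zero _)
  change star (if p.1.1 = i then 1 else 0) = (if p.1.1 = i then 1 else 0)
  split_ifs
  · exact star_one _
  · exact star_zero _

lemma star_unit (i : ℕ) : star (S.unit i) = S.unit i := by
  rw [unit, ← map_star, star_unitAt]

lemma limitOf_le {i : ℕ} {V : ∀ n, Submodule ℂ (S.Stage n)} {J : Submodule ℂ S.Alg}
    (hJ : IsClosed (J : Set S.Alg)) (h : ∀ n, i < n → ∀ x ∈ V n, toLimit S.stageMap n x ∈ J) :
    S.limitOf i V ≤ J := by
  refine Submodule.topologicalClosure_minimal _ (iSup₂_le fun n hn => ?_) hJ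
  rintro _ ⟨x, hx, rfl⟩
  exact h n hn x hx

lemma toLimit_mem_limitOf {i n : ℕ} {V : ∀ n, Submodule ℂ (S.Stage n)} (hn : i < n)
    {x : S.Stage n} (hx : x ∈ V n) : toLimit S.stageMap n x ∈ S.limitOf i V :=
  Submodule.le_topologicalClosure _ (le_iSup₂ (f := fun n (_ : i < n) => (V n).map
    (toLimit S.stageMap n).toAlgHom.toLinearMap) n hn ⟨x, hx, rfl⟩)

lemma isClosed_limitOf (i : ℕ) (V : ∀ n, Submodule ℂ (S.Stage n)) :
    IsClosed (S.limitOf i V : Set S.Alg) := Submodule.isClosed_topologicalClosure _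

lemma mem_of_dense_stages {J : Submodule ℂ S.Alg} (hJ : IsClosed (J : Set S.Alg))
    {f : S.Alg → S.Alg} (hf : Continuous f) (N : ℕ)
    (h : ∀ n, N ≤ n → ∀ z, f (toLimit S.stageMap n z) ∈ J) (x : S.Alg) : f x ∈ J := by
  refine (hJ.preimage hf).closure_subset_iff.2 ?_ (dense_stages N x)
  rintro _ ⟨n, hn, z, rfl⟩
  exact h n hn z

/-- This replaces the closure of a union by an equation. Conversely to the closedness of the
equation, multiplication by `unit i` sends every late stage into the images of the blocks. -/
lemma mem_blockLimit_iff {i : ℕ} {x : S.Alg} : x ∈ S.blockLimit i ↔ S.unit i * x = x := by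
  constructor
  · intro hx
    let J : Submodule ℂ S.Alg := LinearMap.eqLocus (LinearMap.mulLeft ℂ (S.unit i)) LinearMap.id
    refine limitOf_le (J := J) (isClosed_eq (continuous_const_mul (S.unit i)) continuous_id)
      (fun n hn z hz => ?_) hx
    change S.unit i * _ = _
    rw [← toLimit_unitAt hn, ← map_mul, mem_block_iff.1 hz]
    rfl
  · intro hx
    rw [← hx]
    refine mem_of_dense_stages (isClosed_limitOf i _) (continuous_const_mul (S.unit i)) (i + 1)
      (fun n hn z => ?_) x
    rw [← toLimit_unitAt hn, ← map_mul]
    exact toLimit_mem_limitOf hn (unitAt_mul_mem_block n i z)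

lemma mem_coblockLimit_iff {i : ℕ} {x : S.Alg} : x ∈ S.coblockLimit i ↔ S.unit i * x = 0 := by
  constructor
  · intro hx
    refine limitOf_le (J := LinearMap.ker (LinearMap.mulLeft ℂ (S.unit i)))
      (isClosed_eq (continuous_const_mul (S.unit i)) continuous_const) (fun n hn z hz => ?_) hx
    change S.unit i * _ = _
    rw [← toLimit_unitAt hn, ← map_mul, mem_coblock_iff.1 hz, map_zero]
  · intro hx
    have e : x = x - S.unit i * x := by rw [hx, sub_zero]
    rw [e]
    refine mem_of_dense_stages (isClosed_limitOf i _) (f := fun x => x - S.unit i * x)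
      (continuous_id.sub (continuous_const_mul (S.unit i))) (i + 1) (fun n hn z => ?_) x
    rw [← toLimit_unitAt hn, ← map_mul, ← map_sub]
    refine toLimit_mem_limitOf hn (mem_coblock_iff.2 ?_)
    rw [mul_sub, mem_block_iff.1 (unitAt_mul_mem_block n i z), sub_self]

lemma isClosedIdeal_blockLimit (i : ℕ) : IsClosedIdeal (S.blockLimit i) where
  le := le_top
  isClosed := isClosed_limitOf i _
  mul_mem_left x _ y hy := by
    rw [mem_blockLimit_iff] at hy ⊢
    rw [← mul_assoc, unit_mul_comm, mul_assoc, hy]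
  mul_mem_right x _ y hy := by
    rw [mem_blockLimit_iff] at hy ⊢
    rw [← mul_assoc, hy]

lemma isClosedIdeal_coblockLimit (i : ℕ) : IsClosedIdeal (S.coblockLimit i) where
  le := le_top
  isClosed := isClosed_limitOf i _
  mul_mem_left x _ y hy := by
    rw [mem_coblockLimit_iff] at hy ⊢
    rw [← mul_assoc, unit_mul_comm, mul_assoc, hy, mul_zero]
  mul_mem_right x _ y hy := by
    rw [mem_coblockLimit_iff] at hy ⊢
    rw [← mul_assoc, hy, zero_mul]

lemma isCompl_coblockLimit_blockLimit (i : ℕ) :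
    IsCompl (S.coblockLimit i) (S.blockLimit i) := by
  refine ⟨Submodule.disjoint_def.2 fun x hx hx' => ?_, codisjoint_iff.2 <|
    Submodule.eq_top_iff'.2 fun x => Submodule.mem_sup.2
      ⟨x - S.unit i * x, ?_, S.unit i * x, ?_, sub_add_cancel _ _⟩⟩
  · rw [mem_coblockLimit_iff] at hx
    rw [← mem_blockLimit_iff.1 hx', hx]
  · rw [mem_coblockLimit_iff, mul_sub, ← mul_assoc, unit_mul_self, sub_self]
  · rw [mem_blockLimit_iff, ← mul_assoc, unit_mul_self]

lemma blockLimit_le_coblockLimit {i j : ℕ} (h : i ≠ j) : S.blockLimit j ≤ S.coblockLimit i := by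
  intro x hx
  rw [mem_coblockLimit_iff, ← mem_blockLimit_iff.1 hx, ← mul_assoc, unit_mul_unit h, zero_mul]

lemma iSupIndep_blockLimit : iSupIndep S.blockLimit :=
  iSupIndep_of_disjoint (fun i => (isCompl_coblockLimit_blockLimit i).disjoint)
    fun _ _ => blockLimit_le_coblockLimit

end BlockSystem

lemma norm_eq_one_of_isStarProjection {A : Type*} [CStarAlgebra A] {p : A} (hp : IsStarProjection p)
    (h0 : p ≠ 0) : ‖p‖ = 1 := by
  have h := CStarRing.norm_star_mul_self (x := p)
  rw [hp.isSelfAdjoint.star_eq, hp.isIdempotentElem.eq] at h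
  exact (mul_eq_left₀ (norm_ne_zero_iff.2 h0)).1 h.symm

/-! ### Point evaluation and folding of functions. -/

namespace Folding.FoldAlg

variable {q : ℕ} {e : Matrix (Fin q) (Fin q) ℂ} (he : IsStarProjection e) (D : BoundaryData q e)

/-- The map `x ↦ u (x ⊗ 1) u⋆` into the folding interval algebra. -/
def twist (l : ℕ) : TMat q (l + 1) →⋆ₐ[ℂ] FoldAlg D (l + 1) :=
  codRestrict D (l + 1)
    { toFun := fun x => ⟨fun t => D.u l t * tens x 1 * star (D.u l t), by fun_prop⟩
      map_one' := by
        ext1 t; exact map_one ((conjHom (D.u_mem l t)).comp (tensOne q (l + 1)))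
      map_mul' := fun f g => by
        ext1 t; exact map_mul ((conjHom (D.u_mem l t)).comp (tensOne q (l + 1))) f g
      map_zero' := by
        ext1 t; exact map_zero ((conjHom (D.u_mem l t)).comp (tensOne q (l + 1)))
      map_add' := fun f g => by
        ext1 t; exact map_add ((conjHom (D.u_mem l t)).comp (tensOne q (l + 1))) f g
      commutes' := fun c => by
        ext1 t; exact AlgHomClass.commutes ((conjHom (D.u_mem l t)).comp (tensOne q (l + 1))) c
      map_star' := fun f => by
        ext1 t; exact map_star ((conjHom (D.u_mem l t)).comp (tensOne q (l + 1))) f }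
    (fun x => ⟨D.u₀ l x, D.u₁ l x⟩)

variable {D}

/-- Factoring through a full matrix algebra is what makes a nonzero value `f(x)` generate the unit
at the next level. -/
lemma pointEval_eq_twist (x : I) (l : ℕ) (f : FoldAlg D l) :
    pointEval D x l f = twist D l (incl D l f x) := rfl

lemma norm_le {l : ℕ} {f : FoldAlg D l} {c : ℝ} (hc : 0 ≤ c) (h : ∀ t, ‖incl D l f t‖ ≤ c) :
    ‖f‖ ≤ c := (ContinuousMap.norm_le (incl D l f) hc).2 h

lemma incl_fold (l : ℕ) (f : FoldAlg D l) (t : I) :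
    incl D (l + 1) (fold he D l f) t =
      foldMat he (l + 1) (incl D l f (xi₀ t), incl D l f (xi₁ t)) := rfl

/-- The folding map halves the scale on which a function has oscillation at most `c`. -/
lemma norm_incl_fold_sub_le {l : ℕ} {f : FoldAlg D l} {c δ : ℝ}
    (h : ∀ t t' : I, |(t : ℝ) - t'| ≤ δ / 2 → ‖incl D l f t - incl D l f t'‖ ≤ c) (t t' : I)
    (ht : |(t : ℝ) - t'| ≤ δ) :
    ‖incl D (l + 1) (fold he D l f) t - incl D (l + 1) (fold he D l f) t'‖ ≤ c := by
  rw [incl_fold, incl_fold, ← map_sub]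
  -- `foldMat` is contractive for the maximum norm on pairs, and both paths `xi₀`, `xi₁` halve
  -- distances.
  refine (NonUnitalStarAlgHom.norm_apply_le _ _).trans (norm_prod_le_iff.2 ⟨h _ _ ?_, h _ _ ?_⟩)
  · change |(t : ℝ) / 2 - t' / 2| ≤ _
    rw [← sub_div, abs_div, abs_two]
    linarith
  · change |(1 - (t : ℝ) / 2) - (1 - t' / 2)| ≤ _
    rw [show (1 - (t : ℝ) / 2) - (1 - t' / 2) = -((t - t') / 2) by ring, abs_neg, abs_div, abs_two]
    linarith

instance nontrivial [NeZero q] (l : ℕ) : Nontrivial (FoldAlg D l) :=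
  ⟨⟨1, 0, fun h => by
    have h' := congrArg (fun f => incl D l f 0) h
    simp only [map_one, map_zero] at h'
    exact one_ne_zero h'⟩⟩

end Folding.FoldAlg

/-! ### Single entries of a block under an ideal that misses the unit. -/

namespace BlockSystem

open CStarLimit Folding CStarMatrix

variable {S : BlockSystem}

/-- The element of a stage with a given component in the block `(i, l)` and other components
zero. -/
def inBlock (i l : ℕ) (x : S.Block i l) : S.Stage (i + l + 1) :=
  (Pi.single (M := fun p : Idx (i + l + 1) => S.Block p.1.1 p.1.2) ⟨(i, l), rfl⟩ x, 0)

lemma inBlock_same {i l : ℕ} (x : S.Block i l) (h : i + l + 1 = i + l + 1) :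
    (inBlock i l x).1 ⟨(i, l), h⟩ = x :=
  Pi.single_eq_same (M := fun p : Idx (i + l + 1) => S.Block p.1.1 p.1.2) ⟨(i, l), rfl⟩ x

lemma inBlock_mem (i l : ℕ) (x : S.Block i l) : inBlock i l x ∈ S.block (i + l + 1) i :=
  ⟨fun p hp => Pi.single_eq_of_ne (M := fun p : Idx (i + l + 1) => S.Block p.1.1 p.1.2)
    (i := ⟨(i, l), rfl⟩) (i' := p) (fun h => hp (congrArg (fun p => p.1.1) h)) x, rfl⟩

lemma eq_of_mem_block {i l : ℕ} {x y : S.Stage (i + l + 1)} (hx : x ∈ S.block (i + l + 1) i)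
    (hy : y ∈ S.block (i + l + 1) i) (h : x.1 ⟨(i, l), rfl⟩ = y.1 ⟨(i, l), rfl⟩) : x = y := by
  refine Prod.ext (funext fun p => ?_) (hx.2.trans hy.2.symm)
  by_cases hp : p.1.1 = i
  · obtain ⟨⟨j, k⟩, hk⟩ := p
    dsimp only at hp hk
    subst hp
    obtain rfl : k = l := by omega
    exact h
  · exact (hx.1 p hp).trans (hy.1 p hp).symm

lemma eq_inBlock {i l : ℕ} {x : S.Stage (i + l + 1)} (hx : x ∈ S.block (i + l + 1) i) :
    x = inBlock i l (x.1 ⟨(i, l), rfl⟩) :=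
  eq_of_mem_block hx (inBlock_mem _ _ _) (inBlock_same _ _).symm

variable (S) in
/-- The map from a block to the inductive limit. -/
def embed (i l : ℕ) : S.Block i l →⋆ₙₐ[ℂ] S.Alg where
  toFun x := toLimit S.stageMap (i + l + 1) (inBlock i l x)
  map_smul' c x := by
    refine Eq.trans (congrArg _ ?_) (map_smul (toLimit S.stageMap (i + l + 1)) c _)
    exact Prod.ext (Pi.single_smul (f := fun p : Idx (i + l + 1) => S.Block p.1.1 p.1.2) ⟨(i, l), rfl⟩ c x)
      (smul_zero (A := C(I, ℂ)) c).symm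
  map_zero' := by
    refine Eq.trans (congrArg _ ?_) (map_zero (toLimit S.stageMap (i + l + 1)))
    exact Prod.ext (Pi.single_zero (M := fun p : Idx (i + l + 1) => S.Block p.1.1 p.1.2) _) rfl
  map_add' x y := by
    rw [← map_add]
    refine congrArg _ (Prod.ext (Pi.single_add (f := fun p : Idx (i + l + 1) => S.Block p.1.1 p.1.2) ⟨(i, l), rfl⟩ x y) (add_zero _).symm)
  map_mul' x y := by
    rw [← map_mul]
    refine congrArg _ (Prod.ext (Pi.single_mul (α := fun p : Idx (i + l + 1) => S.Block p.1.1 p.1.2) ⟨(i, l), rfl⟩ x y) (mul_zero _).symm)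
  map_star' x := by
    rw [← map_star]
    refine congrArg _ (Prod.ext (Pi.single_star (f := fun p : Idx (i + l + 1) => S.Block p.1.1 p.1.2) ⟨(i, l), rfl⟩ x) (star_zero _).symm)

lemma embed_apply (i l : ℕ) (x : S.Block i l) :
    S.embed i l x = toLimit S.stageMap (i + l + 1) (inBlock i l x) := rfl

lemma stageMap_inBlock (i l : ℕ) (x : S.Block i l) :
    S.stageMap (i + l + 1) (inBlock i l x) = inBlock i (l + 1) (S.blockMap i l x) := by
  refine eq_of_mem_block (l := l + 1) ⟨fun p hp => ?_, map_zero _⟩ (inBlock_mem _ _ _) ?_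
  · obtain ⟨⟨j, k⟩, hk⟩ := p
    cases k with
    | zero => exact map_zero (StarAlgHom.ofId ℂ (S.Block j 0))
    | succ k =>
      change S.blockMap j k ((inBlock i l x).1 ⟨(j, k), _⟩) = 0
      rw [(inBlock_mem i l x).1 _ hp, map_zero]
  · refine Eq.trans ?_ (inBlock_same (l := l + 1) _ _).symm
    exact congrArg (S.blockMap i l) (inBlock_same x _)

lemma embed_blockMap (i l : ℕ) (x : S.Block i l) :
    S.embed i (l + 1) (S.blockMap i l x) = S.embed i l x := by
  rw [embed_apply i l, ← toLimit_comp, stageMap_inBlock]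
  rfl

lemma unitAt_mem_block (n i : ℕ) : S.unitAt n i ∈ S.block n i := ⟨fun _ hp => if_neg hp, rfl⟩

lemma embed_one (i l : ℕ) : S.embed i l 1 = S.unit i := by
  rw [← toLimit_unitAt (show i < i + l + 1 by omega), embed_apply,
    eq_inBlock (unitAt_mem_block (i + l + 1) i), unitAt_fst, if_pos rfl]

/-- Multiplying `y` by `unitAt n i` removes its other components at stage `n` and leaves its image
in the limit unchanged. -/
lemma exists_eq_embed {i n : ℕ} (h : i < n) {y : S.Stage n}
    (hy : S.unit i * toLimit S.stageMap n y = toLimit S.stageMap n y) :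
    ∃ l x, toLimit S.stageMap n y = S.embed i l x := by
  obtain ⟨l, rfl⟩ : ∃ l, n = i + l + 1 := ⟨n - i - 1, by omega⟩
  refine ⟨l, (S.unitAt (i + l + 1) i * y).1 ⟨(i, l), rfl⟩, ?_⟩
  rw [embed_apply, ← hy, ← toLimit_unitAt h, ← map_mul, ← eq_inBlock (unitAt_mul_mem_block _ _ _)]

lemma blockMap_entryAt (i l : ℕ) (a b : Fin (S.size i l)) (f : FoldAlg (S.bd i) l)
    (s t : Fin (S.q i ^ S.r (i + l + 1))) (a' b' : Fin (S.size i l)) :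
    S.blockMap i l (entryAt a b f) (finProdFinEquiv (s, a')) (finProdFinEquiv (t, b')) =
      if s = t then S.entry i l s (if a = a' ∧ b = b' then f else 0) else 0 := by
  rw [← entryAt_apply]
  exact diagFun_apply _ _ _ _ _ _

/-- The location of `x` is forgotten: the oscillation argument only needs a zero of `f` somewhere in
the interval. -/
lemma exists_entry_eq_twist (i l : ℕ) {s : Fin (S.q i ^ S.r (i + l + 1))} (hs : (s : ℕ) ≠ 0) :
    ∃ x : I, ∀ f, S.entry i l s f = FoldAlg.twist (S.bd i) l (FoldAlg.incl (S.bd i) l f x) :=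
  ⟨_, fun f => by rw [entry, if_neg hs, FoldAlg.pointEval_eq_twist]⟩

/-- At the next stage the `s`-th diagonal copy has the twisted nonzero scalar matrix `v` as an
entry, so `one_mem_of_entry` applies to the preimage of `K` in that block. -/
lemma unit_mem_of_entry_eq_twist {K : Submodule ℂ S.Alg} (hK : IsClosedIdeal K) {i l : ℕ}
    {a b : Fin (S.size i l)} {f : FoldAlg (S.bd i) l} (hf : S.embed i l (entryAt a b f) ∈ K)
    {s : Fin (S.q i ^ S.r (i + l + 1))} {v : TMat (S.q i) (l + 1)}
    (hv : S.entry i l s f = FoldAlg.twist (S.bd i) l v) (h : v ≠ 0) : S.unit i ∈ K := by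
  let L : AddSubgroup (S.Block i (l + 1)) :=
    K.toAddSubgroup.comap (S.embed i (l + 1) : S.Block i (l + 1) →+ S.Alg)
  have hL : ∀ x, x ∈ L ↔ S.embed i (l + 1) x ∈ K := fun _ => Iff.rfl
  rw [← embed_one i (l + 1), ← hL]
  refine one_mem_of_entry (FoldAlg.twist (S.bd i) l) h L
    (fun x y hy => ?_) (fun x y hy => ?_) (x := S.blockMap i l (entryAt a b f))
    (p := finProdFinEquiv (s, a)) (q := finProdFinEquiv (s, b)) ?_ ?_
  · rw [hL, map_mul]
    exact hK.mul_mem_left _ trivial _ hy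
  · rw [hL, map_mul]
    exact hK.mul_mem_right _ trivial _ hy
  · rwa [hL, embed_blockMap]
  · rw [blockMap_entryAt, if_pos rfl, if_pos ⟨rfl, rfl⟩, hv]

/-- Only the folding survives, so the image again has a single entry and the argument can be
iterated. -/
lemma blockMap_entryAt_eq {i l : ℕ} {a b : Fin (S.size i l)} {f : FoldAlg (S.bd i) l}
    (hQ : 0 < S.q i ^ S.r (i + l + 1))
    (h : ∀ s : Fin (S.q i ^ S.r (i + l + 1)), (s : ℕ) ≠ 0 → S.entry i l s f = 0) :
    S.blockMap i l (entryAt a b f) =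
      entryAt (finProdFinEquiv (⟨0, hQ⟩, a)) (finProdFinEquiv (⟨0, hQ⟩, b))
        (FoldAlg.fold (S.he i) (S.bd i) l f) := by
  refine ext_prod fun s a' t b' => ?_
  rw [blockMap_entryAt, entryAt_apply]
  simp only [EmbeddingLike.apply_eq_iff_eq, Prod.mk.injEq]
  by_cases hst : s = t
  · subst hst
    rw [if_pos rfl]
    by_cases hs : (s : ℕ) = 0
    · have hs' : (⟨0, hQ⟩ : Fin (S.q i ^ S.r (i + l + 1))) = s := Fin.ext hs.symm
      simp only [hs', true_and]
      split_ifs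
      · rw [entry, if_pos hs]
      · exact map_zero _
    · have hs' : (⟨0, hQ⟩ : Fin (S.q i ^ S.r (i + l + 1))) ≠ s := fun h => hs (h ▸ rfl)
      simp only [hs', false_and, if_false]
      split_ifs
      · exact h s hs
      · exact map_zero _
  · rw [if_neg hst, if_neg]
    rintro ⟨⟨h1, -⟩, h2, -⟩
    exact hst (h1.symm.trans h2)

/-- If the image of a matrix with one entry lies in an ideal that does not contain the unit of the
block, then the repeated foldings of the entry vanish at all evaluation points; so its norm in the
limit is bounded by its oscillation at any scale. -/
lemma norm_embed_entryAt_le {K : Submodule ℂ S.Alg} (hK : IsClosedIdeal K) {i : ℕ}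
    (hi : S.unit i ∉ K) (hq : 2 ≤ S.q i) (hr : ∀ n, S.r n ≠ 0) {c : ℝ} (hc : 0 ≤ c) (m : ℕ) :
    ∀ {l : ℕ} {a b : Fin (S.size i l)} {f : FoldAlg (S.bd i) l},
      S.embed i l (entryAt a b f) ∈ K →
      (∀ t t' : I, |(t : ℝ) - t'| ≤ (1 / 2) ^ m →
        ‖FoldAlg.incl (S.bd i) l f t - FoldAlg.incl (S.bd i) l f t'‖ ≤ c) →
      ‖S.embed i l (entryAt a b f)‖ ≤ c := by
  induction m with
  | zero =>
    intro l a b f hf hosc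
    -- There are at least two diagonal entries, so the one of index 1 is a point evaluation.
    have hQ : 1 < S.q i ^ S.r (i + l + 1) := Nat.one_lt_pow (hr _) hq
    obtain ⟨x, hx⟩ := exists_entry_eq_twist i l (s := ⟨1, hQ⟩) one_ne_zero
    have h0 : FoldAlg.incl (S.bd i) l f x = 0 := by
      by_contra h
      exact hi (unit_mem_of_entry_eq_twist hK hf (hx f) h)
    refine (NonUnitalStarAlgHom.norm_apply_le _ _).trans ((norm_entryAt_le a b f).trans ?_)
    refine FoldAlg.norm_le hc fun t => ?_
    -- At scale `(1 / 2) ^ 0 = 1` any point of the interval can be compared with the zero `x`.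
    have := hosc t x (by
      rw [pow_zero]
      exact abs_sub_le_iff.2 ⟨by linarith [t.2.2, x.2.1], by linarith [t.2.1, x.2.2]⟩)
    rwa [h0, sub_zero] at this
  | succ m ih =>
    intro l a b f hf hosc
    have hQ : 0 < S.q i ^ S.r (i + l + 1) := by positivity
    have h0 : ∀ s : Fin (S.q i ^ S.r (i + l + 1)), (s : ℕ) ≠ 0 → S.entry i l s f = 0 := by
      intro s hs
      obtain ⟨x, hx⟩ := exists_entry_eq_twist i l hs
      rw [hx]
      by_contra h
      refine hi (unit_mem_of_entry_eq_twist hK hf (hx f) fun h0 => h ?_)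
      rw [h0, map_zero]
    have e := blockMap_entryAt_eq (a := a) (b := b) hQ h0
    -- Passing to the next stage keeps the element of the limit, while its entry becomes the folding
    -- of `f`, with the same oscillation bound at twice the scale.
    rw [← embed_blockMap, e] at hf ⊢
    refine ih (l := l + 1) hf (FoldAlg.norm_incl_fold_sub_le (S.he i) fun t t' h => hosc t t' ?_)
    rw [pow_succ]
    linarith

end BlockSystem

/-! ### Simplicity of the block limits. -/

namespace BlockSystem

open CStarLimit Folding CStarMatrix

variable {S : BlockSystem}

lemma unitAt_ne_zero {i : ℕ} (hq : 2 ≤ S.q i) (l : ℕ) : S.unitAt (i + l + 1) i ≠ 0 := by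
  have : NeZero (S.q i) := ⟨by omega⟩
  have hsize : NeZero (S.size i l) := ⟨by
    rw [size_eq]
    exact Finset.prod_ne_zero_iff.2 fun j _ => pow_ne_zero _ (NeZero.ne _)⟩
  intro h
  have h1 : (S.unitAt (i + l + 1) i).1 ⟨(i, l), rfl⟩ = 0 := by rw [h]; rfl
  rw [unitAt_fst, if_pos rfl] at h1
  have h2 : (1 : S.Block i l) 0 0 = 0 := by rw [h1]; rfl
  rw [CStarMatrix.one_apply_eq] at h2
  exact one_ne_zero h2

lemma isStarProjection_unitAt (n i : ℕ) : IsStarProjection (S.unitAt n i) :=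
  ⟨mem_block_iff.1 (unitAt_mem_block n i), star_unitAt n i⟩

lemma trans_unitAt {n m i : ℕ} (hi : i < n) (h : n ≤ m) :
    trans S.stageMap h (S.unitAt n i) = S.unitAt m i := by
  induction m, h using Nat.le_induction with
  | base => rw [trans_self]
  | succ m hm ih => rw [trans_succ _ hm, ih, stageMap_unitAt (hi.trans_le hm)]

/-- The norm in the limit is the limit of the norms at the stages, and there the image is always a
nonzero projection. -/
lemma norm_unit {i : ℕ} (hq : 2 ≤ S.q i) : ‖S.unit i‖ = 1 := by
  refine tendsto_nhds_unique (tendsto_norm_toLimit S.stageMap (i + 1) (S.unitAt (i + 1) i))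
    (tendsto_const_nhds.congr fun k => ?_)
  rw [trans_unitAt (Nat.lt_succ_self i), show i + 1 + k = i + k + 1 by omega]
  exact (norm_eq_one_of_isStarProjection (isStarProjection_unitAt _ _) (unitAt_ne_zero hq k)).symm

lemma unit_mem_blockLimit (i : ℕ) : S.unit i ∈ S.blockLimit i :=
  mem_blockLimit_iff.2 (unit_mul_self i)

/-- Uniform continuity of `f` provides, for each `c > 0`, a dyadic scale at which the oscillation is
at most `c`. -/
lemma embed_entryAt_eq_zero {K : Submodule ℂ S.Alg} (hK : IsClosedIdeal K) {i : ℕ}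
    (hi : S.unit i ∉ K) (hq : 2 ≤ S.q i) (hr : ∀ n, S.r n ≠ 0) {l : ℕ} {a b : Fin (S.size i l)}
    {f : FoldAlg (S.bd i) l} (hf : S.embed i l (entryAt a b f) ∈ K) :
    S.embed i l (entryAt a b f) = 0 := by
  refine norm_le_zero_iff.1 (le_of_forall_pos_le_add fun c hc => ?_)
  rw [zero_add]
  obtain ⟨δ, hδ, h⟩ := Metric.uniformContinuous_iff.1
    (CompactSpace.uniformContinuous_of_continuous (FoldAlg.incl (S.bd i) l f).continuous) c hc
  obtain ⟨m, hm⟩ := exists_pow_lt_of_lt_one hδ (one_half_lt_one (α := ℝ))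
  refine norm_embed_entryAt_le hK hi hq hr hc.le m hf fun t t' htt => ?_
  rw [← dist_eq_norm]
  exact (h (lt_of_le_of_lt htt hm)).le

lemma embed_eq_zero {K : Submodule ℂ S.Alg} (hK : IsClosedIdeal K) {i : ℕ}
    (hi : S.unit i ∉ K) (hq : 2 ≤ S.q i) (hr : ∀ n, S.r n ≠ 0) {l : ℕ} {x : S.Block i l}
    (hx : S.embed i l x ∈ K) : S.embed i l x = 0 := by
  rw [← sum_entryAt x, map_sum]
  refine Finset.sum_eq_zero fun a _ => ?_
  rw [map_sum]
  refine Finset.sum_eq_zero fun b _ => embed_entryAt_eq_zero hK hi hq hr ?_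
  -- Compression by diagonal matrix units isolates each entry of `x` without leaving `K`.
  have e := entryAt_mul_mul a a b b 1 1 x
  rw [one_mul, mul_one] at e
  rw [← e, map_mul, map_mul]
  exact hK.mul_mem_right _ trivial _ (hK.mul_mem_left _ trivial _ hx)

/-- As `s_i` is unital, `K` is an ideal of the whole limit. Either it contains the unit, or
`embed_eq_zero` kills the finite-stage elements that a nonzero `K` would contain. -/
lemma isSimpleIdeal_blockLimit {i : ℕ} (hq : 2 ≤ S.q i) (hr : ∀ n, S.r n ≠ 0) :
    IsSimpleIdeal (S.blockLimit i) where
  isClosedIdeal := isClosedIdeal_blockLimit i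
  ne_bot h := by
    have h1 := unit_mem_blockLimit (S := S) i
    rw [h, Submodule.mem_bot] at h1
    have h2 := norm_unit hq
    rw [h1, norm_zero] at h2
    exact zero_ne_one h2
  eq_bot_or_eq K hKi := by
    have hK : IsClosedIdeal K := hKi.trans_of_unit (isClosedIdeal_blockLimit i)
      (unit_mem_blockLimit i) fun x hx => by
        rw [← unit_mul_comm, mem_blockLimit_iff.1 hx]
        exact ⟨rfl, rfl⟩
    by_cases hi : S.unit i ∈ K
    · refine Or.inr (le_antisymm hKi.le fun x hx => ?_)
      rw [← mem_blockLimit_iff.1 hx]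
      exact hK.mul_mem_right _ trivial _ hi
    · refine Or.inl (by_contra fun h0 => ?_)
      obtain ⟨n, hn, y, hy, hy0⟩ := exists_toLimit_mem S.stageMap hK h0 (i + 1)
      obtain ⟨l, x, hx⟩ := exists_eq_embed hn (mem_blockLimit_iff.1 (hKi.le hy))
      rw [hx] at hy hy0
      exact hy0 (embed_eq_zero hK hi hq hr hy)

/-! ### The scalar part of an element and the common annihilator. -/

variable (S) in
/-- The sum of the units of all blocks of stage `n`. -/
def blocksUnit (n : ℕ) : S.Stage n := (1, 0)

lemma blocksUnit_eq_sum (n : ℕ) : S.blocksUnit n = ∑ i ∈ Finset.range n, S.unitAt n i := by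
  refine Prod.ext (funext fun p => ?_) ?_
  · rw [Prod.fst_sum, Finset.sum_apply]
    simp only [unitAt_fst]
    have hp := p.2
    rw [Finset.sum_ite_eq, if_pos (Finset.mem_range.2 (by omega))]
    rfl
  · rw [Prod.snd_sum]
    exact (Finset.sum_eq_zero fun _ _ => rfl).symm

lemma toLimit_blocksUnit (n : ℕ) :
    toLimit S.stageMap n (S.blocksUnit n) = ∑ i ∈ Finset.range n, S.unit i := by
  rw [blocksUnit_eq_sum, map_sum]
  exact Finset.sum_congr rfl fun i hi => toLimit_unitAt (Finset.mem_range.1 hi)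

lemma isStarProjection_blocksUnit (n : ℕ) : IsStarProjection (S.blocksUnit n) :=
  ⟨Prod.ext (one_mul _) (zero_mul _), Prod.ext (star_one _) (star_zero _)⟩

/-- The scalar in the summand `C([0,1])` of the image in the next stage. -/
lemma snd_stageMap (n : ℕ) (z : S.Stage n) :
    (S.stageMap n z).2 = algebraMap ℂ C(I, ℂ) (z.2 (S.d n)) := rfl

lemma blocksUnit_mul_sub {n : ℕ} {z : S.Stage n} {c : ℂ} (hz : z.2 = algebraMap ℂ C(I, ℂ) c) :
    S.blocksUnit n * (z - algebraMap ℂ _ c) = z - algebraMap ℂ _ c := by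
  refine Prod.ext (one_mul _) ?_
  change 0 * _ = z.2 - algebraMap ℂ C(I, ℂ) c
  rw [zero_mul, hz, sub_self]

/-- The block born at stage `n + 1` has index `n` and receives only the value at 0 of the `C([0,1])`
component, here `c`. -/
lemma unitAt_mul_stageMap {n : ℕ} {z : S.Stage n} {c : ℂ} (hz : z.2 = algebraMap ℂ C(I, ℂ) c) :
    S.unitAt (n + 1) n * S.stageMap n z = c • S.unitAt (n + 1) n := by
  have h : c • S.unitAt (n + 1) n ∈ S.block (n + 1) n :=
    (S.block (n + 1) n).smul_mem c (unitAt_mem_block _ _)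
  refine eq_of_mem_block (i := n) (l := 0) (unitAt_mul_mem_block _ _ _) h ?_
  rw [unitAt_mul]
  change (if n = n then StarAlgHom.ofId ℂ (S.Block n 0) (z.2 0) else 0) =
    c • (if n = n then 1 else 0)
  rw [if_pos rfl, if_pos rfl, hz, ← Algebra.algebraMap_eq_smul_one]
  rfl

/-- An element of the limit is close to an element `w` of the span of a scalar `c` and finitely
many blocks, and the next block sees the scalar. -/
lemma exists_near (x : S.Alg) {ε : ℝ} (hε : 0 < ε) :
    ∃ (n : ℕ) (w : S.Alg) (c : ℂ), ‖x - w‖ < ε ∧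
      (∑ i ∈ Finset.range n, S.unit i) * (w - algebraMap ℂ _ c) = w - algebraMap ℂ _ c ∧
      S.unit n * w = c • S.unit n := by
  obtain ⟨n, -, z, hz⟩ := exists_toLimit_norm_sub_lt S.stageMap 0 x hε
  have hs := snd_stageMap n z
  -- The `C([0,1])` component becomes the constant `z.2 (d n)` only at stage `n + 1`; so blocks `0,
  -- …, n` carry the remainder, and block `n + 1`, born at stage `n + 2`, sees the scalar.
  refine ⟨n + 1, toLimit S.stageMap n z, z.2 (S.d n), hz, ?_, ?_⟩
  · rw [← toLimit_blocksUnit, ← toLimit_comp S.stageMap n z,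
      ← AlgHomClass.commutes (toLimit S.stageMap (n + 1)) (z.2 (S.d n)), ← map_sub, ← map_mul,
      blocksUnit_mul_sub hs]
  · rw [← toLimit_comp, ← toLimit_comp, ← toLimit_unitAt (Nat.lt_succ_self (n + 1)), ← map_mul,
      unitAt_mul_stageMap hs, map_smul]

/-- The units of the block limits have no common annihilator. -/
lemma eq_zero_of_unit_mul (hq : ∀ i, 2 ≤ S.q i) {x : S.Alg} (hx : ∀ i, S.unit i * x = 0) :
    x = 0 := by
  refine norm_le_zero_iff.1 (le_of_forall_pos_le_add fun ε hε => ?_)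
  rw [zero_add]
  obtain ⟨n, w, c, hw, h1, h2⟩ := exists_near x (show 0 < ε / 3 by positivity)
  set P := ∑ i ∈ Finset.range n, S.unit i with hP
  have hproj : IsStarProjection P := by
    rw [hP, ← toLimit_blocksUnit]
    exact (isStarProjection_blocksUnit n).map (toLimit S.stageMap n)
  have hPx : P * x = 0 := by
    rw [hP, Finset.sum_mul]
    exact Finset.sum_eq_zero fun i _ => hx i
  -- `unit n` has norm 1, kills `x` and turns `w` into `c`, so `c` is controlled by the distance of
  -- `w` to `x`.
  have hc : ‖c‖ ≤ ε / 3 := by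
    have e : c • S.unit n = S.unit n * (w - x) := by rw [mul_sub, hx, sub_zero, h2]
    have := congrArg norm e
    rw [norm_smul, norm_unit (hq n), mul_one] at this
    rw [this]
    refine (norm_mul_le _ _).trans ?_
    rw [norm_unit (hq n), one_mul, norm_sub_rev]
    exact hw.le
  -- This is `w = c • (1 - P) + P * w` combined with `P * x = 0`; each of the three terms has norm
  -- at most `ε / 3`.
  have e : x = (x - w) + (c • (1 - P) + P * (w - x)) := by
    rw [mul_sub P w x, hPx, sub_zero]
    rw [mul_sub, Algebra.algebraMap_eq_smul_one, mul_smul_comm, mul_one] at h1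
    rw [smul_sub, ← sub_eq_zero]
    have h1' := sub_eq_zero.2 h1
    rw [← neg_eq_zero, ← h1']
    abel
  rw [e]
  have n1 : ‖c • (1 - P)‖ ≤ ε / 3 := by
    rw [norm_smul]
    exact (mul_le_of_le_one_right (norm_nonneg _) hproj.one_sub.norm_le).trans hc
  have n2 : ‖P * (w - x)‖ ≤ ε / 3 := by
    refine (norm_mul_le _ _).trans ((mul_le_of_le_one_left (norm_nonneg _) hproj.norm_le).trans ?_)
    rw [norm_sub_rev]
    exact hw.le
  have n3 := norm_add_le (c • (1 - P)) (P * (w - x))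
  have n4 := norm_add_le (x - w) (c • (1 - P) + P * (w - x))
  linarith

/-! ### The closed sum of the block limits and its quotient. -/

lemma blockLimit_le_blockSum (i : ℕ) : S.blockLimit i ≤ S.blockSum :=
  (le_iSup _ i).trans (Submodule.le_topologicalClosure _)

lemma blockSum_le {J : Submodule ℂ S.Alg} (hJ : IsClosed (J : Set S.Alg))
    (h : ∀ i, S.blockLimit i ≤ J) : S.blockSum ≤ J :=
  Submodule.topologicalClosure_minimal _ (iSup_le h) hJ

lemma isClosed_blockSum : IsClosed (S.blockSum : Set S.Alg) :=
  Submodule.isClosed_topologicalClosure _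

lemma isClosedIdeal_blockSum : IsClosedIdeal S.blockSum where
  le := le_top
  isClosed := isClosed_blockSum
  mul_mem_left x _ y hy := by
    refine blockSum_le (J := S.blockSum.comap (LinearMap.mulLeft ℂ x))
      (isClosed_blockSum.preimage (continuous_const_mul x)) (fun i z hz => ?_) hy
    exact blockLimit_le_blockSum i ((isClosedIdeal_blockLimit i).mul_mem_left _ trivial _ hz)
  mul_mem_right x _ y hy := by
    refine blockSum_le (J := S.blockSum.comap (LinearMap.mulRight ℂ x))
      (isClosed_blockSum.preimage (continuous_mul_const x)) (fun i z hz => ?_) hy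
    exact blockLimit_le_blockSum i ((isClosedIdeal_blockLimit i).mul_mem_right _ trivial _ hz)

lemma star_mem_blockSum {x : S.Alg} (hx : x ∈ S.blockSum) : star x ∈ S.blockSum := by
  refine blockSum_le (J := S.blockSum.comap (starLinearEquiv ℂ : S.Alg ≃ₗ⋆[ℂ] S.Alg).toLinearMap)
    (isClosed_blockSum.preimage continuous_star) (fun i z hz => ?_) hx
  refine blockLimit_le_blockSum i (mem_blockLimit_iff.2 ?_)
  change S.unit i * star z = star z
  rw [unit_mul_comm, ← star_unit, ← star_mul, mem_blockLimit_iff.1 hz]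

lemma one_notMem_blockSum (hq : ∀ i, 2 ≤ S.q i) : (1 : S.Alg) ∉ S.blockSum := by
  intro h
  obtain ⟨y, hy, hy1⟩ := Metric.mem_closure_iff.1 h 1 one_pos
  -- `y` lies in the algebraic sum, so it involves finitely many blocks; a later `unit N` gives `1 =
  -- ‖unit N * (1 - y)‖ ≤ ‖1 - y‖`.
  obtain ⟨N, hN⟩ : ∃ N, ∀ n, N ≤ n → S.unit n * y = 0 := by
    refine Submodule.iSup_induction _ (motive := fun y => ∃ N, ∀ n, N ≤ n → S.unit n * y = 0) hy
      (fun i x hx => ⟨i + 1, fun n hn => ?_⟩) ⟨0, fun n _ => mul_zero _⟩ ?_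
    · exact mem_coblockLimit_iff.1 (blockLimit_le_coblockLimit (by omega) hx)
    · rintro x x' ⟨N, hN⟩ ⟨N', hN'⟩
      refine ⟨max N N', fun n hn => ?_⟩
      rw [mul_add, hN n (le_of_max_le_left hn), hN' n (le_of_max_le_right hn), add_zero]
  have e : S.unit N = S.unit N * (1 - y) := by rw [mul_sub, mul_one, hN N le_rfl, sub_zero]
  have h1 := congrArg norm e
  have h2 := norm_mul_le (S.unit N) (1 - y)
  rw [← h1, norm_unit (hq N), one_mul, ← dist_eq_norm] at h2
  exact absurd hy1 h2.not_gt

lemma exists_sub_algebraMap_mem_blockSum (x : S.Alg) :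
    ∃ c : ℂ, x - algebraMap ℂ S.Alg c ∈ S.blockSum := by
  -- Adding a finite-dimensional subspace keeps a subspace closed, so it suffices to approximate `x`
  -- by elements of this sum.
  have hcl : IsClosed ((S.blockSum ⊔ Submodule.span ℂ {(1 : S.Alg)} : Submodule ℂ S.Alg) :
      Set S.Alg) := Submodule.isClosed_sup_finiteDimensional _ _ isClosed_blockSum
  have hx : x ∈ S.blockSum ⊔ Submodule.span ℂ {(1 : S.Alg)} := by
    rw [← SetLike.mem_coe, ← hcl.closure_eq]
    refine Metric.mem_closure_iff.2 fun ε hε => ?_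
    obtain ⟨n, w, c, hw, h1, -⟩ := exists_near x hε
    refine ⟨w, Submodule.mem_sup.2 ⟨w - algebraMap ℂ _ c, ?_, algebraMap ℂ _ c,
      Submodule.mem_span_singleton.2 ⟨c, (Algebra.algebraMap_eq_smul_one c).symm⟩,
      sub_add_cancel _ _⟩, by rwa [dist_eq_norm]⟩
    rw [← h1, Finset.sum_mul]
    exact sum_mem fun i _ => blockLimit_le_blockSum i
      ((isClosedIdeal_blockLimit i).mul_mem_right _ trivial _ (unit_mem_blockLimit i))
  obtain ⟨y, hy, z, hz, rfl⟩ := Submodule.mem_sup.1 hx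
  obtain ⟨c, rfl⟩ := Submodule.mem_span_singleton.1 hz
  refine ⟨c, ?_⟩
  rwa [Algebra.algebraMap_eq_smul_one, add_sub_cancel_right]

/-- The structure of the inductive limit of a block system. -/
theorem ideal_structure (hq : ∀ i, 2 ≤ S.q i) (hr : ∀ n, S.r n ≠ 0) :
    {J : Submodule ℂ S.Alg | IsSimpleIdeal J} = Set.range S.blockLimit ∧
      (∀ i, IsClosedIdeal (S.coblockLimit i) ∧ IsClosedIdeal (S.blockLimit i) ∧
        IsCompl (S.coblockLimit i) (S.blockLimit i)) ∧
      iSupIndep S.blockLimit ∧ Nonempty (QuotientIso S.blockSum ℂ) :=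
  ⟨setOf_isSimpleIdeal_eq (fun i => isSimpleIdeal_blockLimit (hq i) hr) unit_mem_blockLimit
      fun _ => eq_zero_of_unit_mul hq,
    fun i => ⟨isClosedIdeal_coblockLimit i, isClosedIdeal_blockLimit i,
      isCompl_coblockLimit_blockLimit i⟩,
    iSupIndep_blockLimit,
    nonempty_quotientIso isClosedIdeal_blockSum (one_notMem_blockSum hq)
      (fun _ => star_mem_blockSum) exists_sub_algebraMap_mem_blockSum⟩

end BlockSystem

/-! ### The two sequences of the theorem as block systems. -/

lemma two_le_sizeSeq (k : ℕ) : 2 ≤ sizeSeq k := by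
  have hp : ∀ k, (primeSeq k).Prime := fun k => Nat.prime_nth_prime k
  have h : 1 ≤ prevPrime k := by
    cases k with
    | zero => exact le_rfl
    | succ k => exact (hp k).one_lt.le
  exact (hp k).two_le.trans (Nat.le_mul_of_pos_right _ h)

end

theorem mainTheorem5
    (d : ℕ → unitInterval) (hd : DenseRange d)
    (r : ℕ → ℕ) (hr : StrictMono r) (hr0 : 2 ≤ r 0)
    (eA eB : ∀ k, Matrix (Fin (sizeSeq k)) (Fin (sizeSeq k)) ℂ)
    (heA : ∀ k, IsStarProjection (eA k)) (heB : ∀ k, IsStarProjection (eB k))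
    (hrankA : ∀ k, (eA k).rank = prevPrime k) (hrankB : ∀ k, (eB k).rank = primeSeq k)
    (bdA : ∀ k, Folding.BoundaryData (sizeSeq k) (eA k))
    (bdB : ∀ k, Folding.BoundaryData (sizeSeq k) (eB k))
    (SA SB : BlockSystem)
    (hSA : SA = { q := sizeSeq, r := r, d := d, e := eA, he := heA, bd := bdA })
    (hSB : SB = { q := sizeSeq, r := r, d := d, e := eB, he := heB, bd := bdB }) :
    ({J : Submodule ℂ SA.Alg | IsSimpleIdeal J} = Set.range SA.blockLimit ∧
      {J : Submodule ℂ SB.Alg | IsSimpleIdeal J} = Set.range SB.blockLimit) ∧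
    (∀ i,
      (IsClosedIdeal (SA.coblockLimit i) ∧ IsClosedIdeal (SA.blockLimit i) ∧
        IsCompl (SA.coblockLimit i) (SA.blockLimit i)) ∧
      (IsClosedIdeal (SB.coblockLimit i) ∧ IsClosedIdeal (SB.blockLimit i) ∧
        IsCompl (SB.coblockLimit i) (SB.blockLimit i))) ∧
    (iSupIndep SA.blockLimit ∧ iSupIndep SB.blockLimit ∧
      Nonempty (QuotientIso SA.blockSum ℂ) ∧ Nonempty (QuotientIso SB.blockSum ℂ)) := by
  have hr' : ∀ n, r n ≠ 0 := fun n => by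
    have := hr.monotone (Nat.zero_le n)
    omega
  subst hSA hSB
  have hA := BlockSystem.ideal_structure (S := ⟨sizeSeq, r, d, eA, heA, bdA⟩) two_le_sizeSeq hr'
  have hB := BlockSystem.ideal_structure (S := ⟨sizeSeq, r, d, eB, heB, bdB⟩) two_le_sizeSeq hr'
  exact ⟨⟨hA.1, hB.1⟩, fun i => ⟨hA.2.1 i, hB.2.1 i⟩, hA.2.2.1, hB.2.2.1, hA.2.2.2, hB.2.2.2⟩
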